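/- A (one-dimensional, discrete-time) quantum walk is a triple $(\mathcal H,(U^t)_{t\in\mathbb Z},D)$ of a complex Hilbert space $\mathcal H$, a unitary operator $U$ on $\mathcal H$ with its powers $U^t$, and a (possibly unbounded) self-adjoint operator $D$ on $\mathcal H$. A bounded operator $X\colon\mathcal H_1\to\mathcal H_2$ is smooth with respect to self-adjoint operators $D_1$ on $\mathcal H_1$ and $D_2$ on $\mathcal H_2$ if $\mathbb R\ni k\mapsto e^{ikD_2}Xe^{-ikD_1}$ is a $C^\infty$ map into the bounded operators with the operator norm. The walk is smooth if, for every $t\in\mathbb Z$, $U^t$ is smooth with respect to $D$ and $D$. A vector $\xi$ is smooth with respect to $D$ if $\xi\in\bigcap_{m\in\mathbb N}\mathrm{dom}(D^m)$. Let $E$ be the spectral measure of $D$, let $\xi$ be a unit vector, and for integers $t\ge 1$ let $p_t$ be the probability measure $p_t(\Omega)=\langle E(t\Omega)U^t\xi,U^t\xi\rangle$ on the Borel subsets $\Omega$ of $\mathbb R$. If $p_t$ converges weakly (tested against bounded continuous functions) as $t\to\infty$, the limit is called the limit distribution of the walk with respect to $\xi$. **Theorem.** Let $(\mathcal H_1,(U_1^t)_{t\in\mathbb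 Z},D_1)$ and $(\mathcal H_2,(U_2^t)_{t\in\mathbb Z},D_2)$ be smooth quantum walks, and let $V\colon\mathcal H_1\to\mathcal H_2$ be a unitary operator which gives similarity between them, that is, $VU_1=U_2V$ and $V$ is smooth with respect to $D_1$ and $D_2$. Let $\xi\in\mathcal H_1$ be a unit vector which is smooth with respect to $D_1$. Then $V\xi$ is smooth with respect to $D_2$. The walk $(\mathcal H_2,(U_2^t)_{t\in\mathbb Z},D_2)$ has a limit distribution with respect to $V\xi$ if and only if $(\mathcal H_1,(U_1^t)_{t\in\mathbb Z},D_1)$ has a limit distribution with respect to $\xi$, and in this case the two limit distributions coincide. -/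

import Mathlib

open MeasureTheory Filter Topology
open scoped ContDiff

/-- A projection-valued measure on the Borel subsets of the real line: every Borel set is sent to an
orthogonal projection of `H`, the whole line is sent to the identity, and the assignment is
countably additive in the strong operator topology. -/
structure ProjectionValuedMeasure (H : Type*) [NormedAddCommGroup H] [InnerProductSpace ℂ H]
    [CompleteSpace H] where
  proj : Set ℝ → H →L[ℂ] H
  isStarProjection_proj : ∀ B : Set ℝ, MeasurableSet B → IsStarProjection (proj B)
  proj_univ : proj Set.univ = 1
  hasSum_proj : ∀ B : ℕ → Set ℝ, (∀ n, MeasurableSet (B n)) →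
    Pairwise (Function.onFun Disjoint B) → ∀ ξ : H,
      HasSum (fun n => proj (B n) ξ) (proj (⋃ n, B n) ξ)

namespace ProjectionValuedMeasure

variable {H : Type*} [NormedAddCommGroup H] [InnerProductSpace ℂ H] [CompleteSpace H]

/-- The point mass at the origin is a projection-valued measure. -/
instance : Nonempty (ProjectionValuedMeasure H) := by
  classical
  refine ⟨{ proj := fun B => if (0 : ℝ) ∈ B then 1 else 0
            isStarProjection_proj := ?_, proj_univ := by simp, hasSum_proj := ?_ }⟩
  · intro B _
    split_ifs
    · exact IsStarProjection.one _
    · exact IsStarProjection.zero _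
  · intro B _ hd ξ
    by_cases h : ∃ n, (0 : ℝ) ∈ B n
    · obtain ⟨n, hn⟩ := h
      have h1 : (0 : ℝ) ∈ ⋃ n, B n := Set.mem_iUnion.2 ⟨n, hn⟩
      have h2 : ∀ m, m ≠ n → (0 : ℝ) ∉ B m := fun m hm h0 =>
        Set.disjoint_left.1 (hd hm) h0 hn
      have := hasSum_single (f := fun m => (if (0 : ℝ) ∈ B m then (1 : H →L[ℂ] H) else 0) ξ) n
        (fun m hm => by simp [h2 m hm])
      simpa [h1, hn] using this
    · have h1 : (0 : ℝ) ∉ ⋃ n, B n := by simpa using h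
      push Not at h
      simp only [h, h1, if_false]
      simp

variable (E : ProjectionValuedMeasure H)

theorem proj_empty : E.proj ∅ = 0 := by
  ext ξ
  have h := E.hasSum_proj (fun _ => ∅) (fun _ => MeasurableSet.empty)
    (fun _ _ _ => by simp [Function.onFun]) ξ
  have h2 := h.summable.tendsto_atTop_zero
  simpa using tendsto_nhds_unique tendsto_const_nhds h2

theorem inner_proj {B : Set ℝ} (hB : MeasurableSet B) (ξ : H) :
    inner ℂ ξ (E.proj B ξ) = ((‖E.proj B ξ‖ ^ 2 : ℝ) : ℂ) := by
  have h := E.isStarProjection_proj B hB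
  have h1 : E.proj B (E.proj B ξ) = E.proj B ξ := by
    have := congrArg (fun A : H →L[ℂ] H => A ξ) h.isIdempotentElem.eq
    simpa using this
  have h2 : inner ℂ (E.proj B ξ) (E.proj B ξ) = inner ℂ ξ (E.proj B (E.proj B ξ)) := by
    have h3 : ContinuousLinearMap.adjoint (E.proj B) = E.proj B := h.isSelfAdjoint
    conv_rhs => rw [← ContinuousLinearMap.adjoint_inner_left, h3]
  rw [h1] at h2
  rw [← h2, inner_self_eq_norm_sq_to_K]
  simp

/-- The Borel measure `B ↦ ⟨E(B) ξ, ξ⟩` on the real line. -/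
noncomputable def measure (ξ : H) : Measure ℝ :=
  Measure.ofMeasurable (fun B _ => ENNReal.ofReal (inner ℂ ξ (E.proj B ξ)).re)
    (by simp [E.proj_empty])
    (by
      intro B hB hd
      have h := ((E.hasSum_proj B hB hd ξ).mapL (innerSL ℂ ξ)).mapL Complex.reCLM
      simp only [innerSL_apply_apply, Complex.reCLM_apply] at h
      have hn : ∀ n, 0 ≤ (inner ℂ ξ (E.proj (B n) ξ)).re := fun n => by
        rw [E.inner_proj (hB n), Complex.ofReal_re]; positivity
      rw [← h.tsum_eq, ENNReal.ofReal_tsum_of_nonneg hn h.summable])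

theorem measure_apply (ξ : H) {B : Set ℝ} (hB : MeasurableSet B) :
    E.measure ξ B = ENNReal.ofReal (inner ℂ ξ (E.proj B ξ)).re :=
  Measure.ofMeasurable_apply B hB

theorem measure_univ (ξ : H) : E.measure ξ Set.univ = ENNReal.ofReal (‖ξ‖ ^ 2) := by
  rw [E.measure_apply ξ MeasurableSet.univ, E.inner_proj MeasurableSet.univ, Complex.ofReal_re,
    E.proj_univ]
  rfl

instance isFiniteMeasure_measure (ξ : H) : IsFiniteMeasure (E.measure ξ) :=
  ⟨by rw [E.measure_univ]; exact ENNReal.ofReal_lt_top⟩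

theorem measureReal_eq (ξ : H) {B : Set ℝ} (hB : MeasurableSet B) :
    (((E.measure ξ).real B : ℝ) : ℂ) = inner ℂ ξ (E.proj B ξ) := by
  rw [Measure.real, E.measure_apply ξ hB, E.inner_proj hB, Complex.ofReal_re,
    ENNReal.toReal_ofReal (by positivity)]

theorem norm_le_of_quadratic_bound (A : H →L[ℂ] H) (c : ℝ) (hc : 0 ≤ c)
    (h : ∀ ξ, ‖inner ℂ ξ (A ξ)‖ ≤ c * ‖ξ‖ ^ 2) : ‖A‖ ≤ 2 * c := by
  have h' : ∀ ξ, ‖inner ℂ (A ξ) ξ‖ ≤ c * ‖ξ‖ ^ 2 := fun ξ => by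
    rw [norm_inner_symm]; exact h ξ
  have key : ∀ x y : H, ‖inner ℂ (A y) x‖ ≤ c * (‖x‖ ^ 2 + ‖y‖ ^ 2) := by
    intro x y
    have hp := inner_map_polarization (A : H →ₗ[ℂ] H) x y
    simp only [ContinuousLinearMap.coe_coe] at hp
    rw [hp]
    have hp1 := parallelogram_law_with_norm ℂ x y
    have hp2 := parallelogram_law_with_norm ℂ x (Complex.I • y)
    have hI : ‖Complex.I • y‖ = ‖y‖ := by rw [norm_smul]; simp
    rw [hI] at hp2
    have b1 := h' (x + y)
    have b2 := h' (x - y)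
    have b3 := h' (x + Complex.I • y)
    have b4 := h' (x - Complex.I • y)
    rw [norm_div]
    have h4 : ‖(4 : ℂ)‖ = 4 := by simp
    rw [h4, div_le_iff₀ (by norm_num)]
    have n1 : ∀ a b d e : ℂ, ‖a - b + Complex.I * d - Complex.I * e‖
        ≤ ‖a‖ + ‖b‖ + ‖d‖ + ‖e‖ := fun a b d e => by
      have hd : ‖Complex.I * d‖ = ‖d‖ := by rw [norm_mul, Complex.norm_I, one_mul]
      have he : ‖Complex.I * e‖ = ‖e‖ := by rw [norm_mul, Complex.norm_I, one_mul]
      have := norm_sub_le (a - b + Complex.I * d) (Complex.I * e)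
      have := norm_add_le (a - b) (Complex.I * d)
      have := norm_sub_le a b
      linarith
    refine (n1 _ _ _ _).trans ?_
    have hs := congrArg₂ (fun p q => c * (p + q)) hp1 hp2
    linarith
  refine ContinuousLinearMap.opNorm_le_bound _ (by positivity) fun x => ?_
  by_cases hx : A x = 0
  · rw [hx, norm_zero]; positivity
  have ha : 0 < ‖A x‖ := norm_pos_iff.2 hx
  have hx0 : 0 < ‖x‖ := norm_pos_iff.2 (by rintro rfl; simp at hx)
  have hk := key (((‖x‖ / ‖A x‖ : ℝ) : ℂ) • A x) x
  have e1 : ‖((‖x‖ / ‖A x‖ : ℝ) : ℂ) • A x‖ = ‖x‖ := by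
    rw [norm_smul, Complex.norm_real, Real.norm_of_nonneg (by positivity)]
    field_simp
  have e2 : ‖inner ℂ (A x) (((‖x‖ / ‖A x‖ : ℝ) : ℂ) • A x)‖ = ‖x‖ * ‖A x‖ := by
    rw [inner_smul_right, inner_self_eq_norm_sq_to_K, norm_mul, Complex.norm_real,
      Real.norm_of_nonneg (by positivity)]
    simp
    field_simp
  rw [e1, e2] at hk
  have : ‖x‖ * ‖A x‖ ≤ ‖x‖ * (2 * c * ‖x‖) := by nlinarith
  exact le_of_mul_le_mul_left this hx0

theorem exists_simpleFunc_near (f : ℝ → ℂ) (hf : Measurable f) (C : ℝ) (hC : ∀ x, ‖f x‖ ≤ C)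
    (ε : ℝ) (hε : 0 < ε) : ∃ g : SimpleFunc ℝ ℂ, ∀ x, ‖f x - g x‖ ≤ ε := by
  obtain ⟨t, ht⟩ := (isCompact_closedBall (0 : ℂ) C).elim_finite_subcover
    (fun i : ℕ => Metric.ball (TopologicalSpace.denseSeq ℂ i) ε) (fun _ => Metric.isOpen_ball)
    (fun z _ => by
      obtain ⟨i, hi⟩ := (TopologicalSpace.denseRange_denseSeq ℂ).exists_dist_lt z hε
      exact Set.mem_iUnion.2 ⟨i, hi⟩)
  refine ⟨(SimpleFunc.nearestPt (TopologicalSpace.denseSeq ℂ) (t.sup id)).comp f hf, fun x => ?_⟩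
  have hx : f x ∈ Metric.closedBall (0 : ℂ) C := by simpa using hC x
  obtain ⟨i, hit, hi⟩ := Set.mem_iUnion₂.1 (ht hx)
  have h1 := SimpleFunc.edist_nearestPt_le (TopologicalSpace.denseSeq ℂ) (f x)
    (Finset.le_sup (f := id) hit : i ≤ t.sup id)
  rw [edist_dist, edist_dist, ENNReal.ofReal_le_ofReal_iff dist_nonneg] at h1
  rw [← dist_eq_norm, dist_comm, SimpleFunc.coe_comp, Function.comp_apply]
  refine h1.trans ?_
  rw [dist_comm]
  exact (Metric.mem_ball.1 hi).le

theorem exists_integral_simpleFunc (g : SimpleFunc ℝ ℂ) :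
    ∃ A : H →L[ℂ] H, ∀ ξ : H, inner ℂ ξ (A ξ) = ∫ x, g x ∂(E.measure ξ) := by
  refine ⟨∑ c ∈ g.range, c • E.proj (g ⁻¹' {c}), fun ξ => ?_⟩
  rw [← SimpleFunc.integral_eq_integral _ (SimpleFunc.integrable_of_isFiniteMeasure g),
    SimpleFunc.integral_eq, sum_apply, inner_sum]
  refine Finset.sum_congr rfl fun c _ => ?_
  rw [_root_.smul_apply, inner_smul_right,
    ← E.measureReal_eq ξ (g.measurableSet_fiber c), mul_comm, Complex.real_smul]

/-- Bounded Borel functions can be integrated against a projection-valued measure. -/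
theorem exists_integral (f : ℝ → ℂ) (hf : Measurable f) (C : ℝ) (hC : ∀ x, ‖f x‖ ≤ C) :
    ∃ A : H →L[ℂ] H, ∀ ξ : H, inner ℂ ξ (A ξ) = ∫ x, f x ∂(E.measure ξ) := by
  have hpos : ∀ n : ℕ, (0 : ℝ) < 1 / ((n : ℝ) + 1) := fun n => by positivity
  choose g hg using fun n : ℕ => exists_simpleFunc_near f hf C hC _ (hpos n)
  choose A hA using fun n : ℕ => E.exists_integral_simpleFunc (g n)
  have hreal : ∀ ξ : H, (E.measure ξ).real Set.univ = ‖ξ‖ ^ 2 := fun ξ => by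
    rw [Measure.real, E.measure_univ, ENNReal.toReal_ofReal (by positivity)]
  have hfi : ∀ ξ : H, Integrable f (E.measure ξ) := fun ξ =>
    Integrable.of_bound hf.aestronglyMeasurable C (Eventually.of_forall hC)
  have hgi : ∀ n (ξ : H), Integrable (g n) (E.measure ξ) := fun n ξ =>
    SimpleFunc.integrable_of_isFiniteMeasure _
  have hdiff : ∀ n (ξ : H), ‖inner ℂ ξ (A n ξ) - ∫ x, f x ∂(E.measure ξ)‖
      ≤ 1 / ((n : ℝ) + 1) * ‖ξ‖ ^ 2 := fun n ξ => by
    rw [hA n ξ, ← integral_sub (hgi n ξ) (hfi ξ), ← hreal ξ]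
    refine norm_integral_le_of_norm_le_const (Eventually.of_forall fun x => ?_)
    rw [norm_sub_rev]
    exact hg n x
  have hcauchy : CauchySeq A := by
    refine cauchySeq_of_le_tendsto_0 (fun n : ℕ => 4 * (1 / ((n : ℝ) + 1))) ?_ ?_
    · intro n m N hn hm
      rw [dist_eq_norm]
      have hb : ∀ k, N ≤ k → 1 / ((k : ℝ) + 1) ≤ 1 / ((N : ℝ) + 1) := fun k hk =>
        Nat.one_div_le_one_div hk
      have := norm_le_of_quadratic_bound (A n - A m) (2 * (1 / ((N : ℝ) + 1)))
        (by positivity) (fun ξ => by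
          have e : inner ℂ ξ ((A n - A m) ξ) = (inner ℂ ξ (A n ξ) - ∫ x, f x ∂(E.measure ξ))
              - (inner ℂ ξ (A m ξ) - ∫ x, f x ∂(E.measure ξ)) := by
            rw [_root_.sub_apply, inner_sub_right]; ring
          rw [e]
          refine (norm_sub_le _ _).trans ?_
          have h1 := (hdiff n ξ).trans (mul_le_mul_of_nonneg_right (hb n hn) (sq_nonneg ‖ξ‖))
          have h2 := (hdiff m ξ).trans (mul_le_mul_of_nonneg_right (hb m hm) (sq_nonneg ‖ξ‖))
          linarith)
      linarith
    · simpa using tendsto_one_div_add_atTop_nhds_zero_nat.const_mul (4 : ℝ)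
  obtain ⟨B, hB⟩ := cauchySeq_tendsto_of_complete hcauchy
  refine ⟨B, fun ξ => ?_⟩
  have h1 : Tendsto (fun n => inner ℂ ξ (A n ξ)) atTop (𝓝 (inner ℂ ξ (B ξ))) :=
    tendsto_const_nhds.inner
      (((ContinuousLinearMap.apply ℂ H ξ).continuous.tendsto B).comp hB)
  have h2 : Tendsto (fun n => inner ℂ ξ (A n ξ)) atTop (𝓝 (∫ x, f x ∂(E.measure ξ))) := by
    rw [tendsto_iff_norm_sub_tendsto_zero]
    refine squeeze_zero (fun _ => norm_nonneg _) (fun n => hdiff n ξ) ?_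
    simpa using tendsto_one_div_add_atTop_nhds_zero_nat.mul_const (‖ξ‖ ^ 2)
  exact tendsto_nhds_unique h1 h2

/-- The unitary operator `∫ exp (i k x) dE(x)`: the operator `A` with
`⟨A ξ, ξ⟩ = ∫ exp (i k x) ⟨E(dx) ξ, ξ⟩` for every `ξ`, which is unique by polarization. -/
noncomputable def expI (k : ℝ) : H →L[ℂ] H :=
  (E.exists_integral (fun x => Complex.exp (Complex.I * k * x)) (by fun_prop) 1 (by
    intro x
    have : Complex.I * k * x = ((k * x : ℝ) : ℂ) * Complex.I := by push_cast; ring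
    rw [this, Complex.norm_exp_ofReal_mul_I])).choose

theorem inner_expI (k : ℝ) (ξ : H) :
    inner ℂ ξ (E.expI k ξ) = ∫ x : ℝ, Complex.exp (Complex.I * k * x) ∂(E.measure ξ) :=
  (E.exists_integral (fun x => Complex.exp (Complex.I * k * x)) (by fun_prop) 1 (by
    intro x
    have : Complex.I * k * x = ((k * x : ℝ) : ℂ) * Complex.I := by push_cast; ring
    rw [this, Complex.norm_exp_ofReal_mul_I])).choose_spec ξ

/-- `E` is the spectral measure of the (possibly unbounded) operator `D`, that is `D = ∫ x dE(x)`: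
the domain of `D` consists of the vectors `ξ` with `∫ x ^ 2 ⟨E(dx) ξ, ξ⟩ < ∞`, and
`⟨D ξ, ξ⟩ = ∫ x ⟨E(dx) ξ, ξ⟩` for `ξ` in the domain. -/
def IsSpectralMeasureOf (D : H →ₗ.[ℂ] H) : Prop :=
  (∀ ξ : H, ξ ∈ D.domain ↔ Integrable (fun x : ℝ => x ^ 2) (E.measure ξ)) ∧
    ∀ ξ : D.domain, inner ℂ (ξ : H) (D ξ) = ((∫ x : ℝ, x ∂(E.measure (ξ : H)) : ℝ) : ℂ)

end ProjectionValuedMeasure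

section Operators

variable {H : Type*} [NormedAddCommGroup H] [InnerProductSpace ℂ H] [CompleteSpace H]
variable {H' : Type*} [NormedAddCommGroup H'] [InnerProductSpace ℂ H'] [CompleteSpace H']

/-- The spectral measure of a self-adjoint operator `D`. (It exists and is unique by the spectral
theorem; nothing is meant when `D` is not self-adjoint.) -/
noncomputable def spectralMeasure (D : H →ₗ.[ℂ] H) : ProjectionValuedMeasure H :=
  Classical.epsilon fun E => E.IsSpectralMeasureOf D

/-- The unitary operator `exp (i k D)` for a self-adjoint operator `D`. -/
noncomputable def expI (D : H →ₗ.[ℂ] H) (k : ℝ) : H →L[ℂ] H :=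
  (spectralMeasure D).expI k

/-- A bounded operator `X : H → H'` is smooth with respect to `D` and `D'` if
`k ↦ exp (i k D') X exp (- i k D)` is a smooth map from the real line to the bounded operators with
the operator norm. -/
def IsSmoothOperator (D : H →ₗ.[ℂ] H) (D' : H' →ₗ.[ℂ] H') (X : H →L[ℂ] H') : Prop :=
  ContDiff ℝ ∞ fun k : ℝ => expI D' k ∘L X ∘L expI D (-k)

/-- `ξ` belongs to the domain of `D ^ m`. -/
def MemDomainPow (D : H →ₗ.[ℂ] H) : ℕ → H → Prop
  | 0, _ => True
  | m + 1, ξ => ∃ hξ : ξ ∈ D.domain, MemDomainPow D m (D ⟨ξ, hξ⟩)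

/-- `ξ` is smooth with respect to `D`: it belongs to the domain of every power of `D`. -/
def IsSmoothVector (D : H →ₗ.[ℂ] H) (ξ : H) : Prop :=
  ∀ m : ℕ, MemDomainPow D m ξ

end Operators

/-- A one-dimensional discrete-time quantum walk `(H, (U ^ t), D)`: a unitary operator `U`, which
generates the unitary representation `t ↦ U ^ t` of the integers, and a self-adjoint operator `D`,
which may be unbounded. -/
structure QuantumWalk (H : Type*) [NormedAddCommGroup H] [InnerProductSpace ℂ H]
    [CompleteSpace H] where
  U : unitary (H →L[ℂ] H)
  D : H →ₗ.[ℂ] H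
  isSelfAdjoint_D : IsSelfAdjoint D

namespace QuantumWalk

variable {H : Type*} [NormedAddCommGroup H] [InnerProductSpace ℂ H] [CompleteSpace H]
variable {H' : Type*} [NormedAddCommGroup H'] [InnerProductSpace ℂ H'] [CompleteSpace H']

/-- The operator `U ^ t`. -/
noncomputable def evolution (W : QuantumWalk H) (t : ℤ) : H →L[ℂ] H :=
  ((W.U ^ t : unitary (H →L[ℂ] H)) : H →L[ℂ] H)

/-- The walk is smooth if every `U ^ t` is smooth with respect to `D`. -/
def IsSmooth (W : QuantumWalk H) : Prop :=
  ∀ t : ℤ, IsSmoothOperator W.D W.D (W.evolution t)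

/-- A bounded operator `X` is an intertwiner between two walks if `X U = U' X`. -/
def IsIntertwiner (W : QuantumWalk H) (W' : QuantumWalk H') (X : H →L[ℂ] H') : Prop :=
  X ∘L W.evolution 1 = W'.evolution 1 ∘L X

/-- The unitary operator `V` gives similarity between two walks if it is a smooth intertwiner. -/
def IsSimilarityBy (W : QuantumWalk H) (W' : QuantumWalk H') (V : H ≃ₗᵢ[ℂ] H') : Prop :=
  W.IsIntertwiner W' (V.toContinuousLinearEquiv : H →L[ℂ] H') ∧
    IsSmoothOperator W.D W'.D (V.toContinuousLinearEquiv : H →L[ℂ] H')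

/-- The distribution `p_t` at time `t` of the walk with initial vector `ξ`: the push-forward of
`B ↦ ⟨E(B) U ^ t ξ, U ^ t ξ⟩`, where `E` is the spectral measure of `D`, under `x ↦ x / t`. -/
noncomputable def distribution (W : QuantumWalk H) (ξ : H) (t : ℕ) : FiniteMeasure ℝ :=
  ⟨((spectralMeasure W.D).measure (W.evolution t ξ)).map (fun x : ℝ => x / (t : ℝ)), inferInstance⟩

/-- `μ` is the limit distribution of the walk with respect to `ξ`: the measures `p_t` converge
weakly to `μ` (against bounded continuous functions) as `t → ∞`. -/
def IsLimitDistribution (W : QuantumWalk H) (ξ : H) (μ : FiniteMeasure ℝ) : Prop :=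
  Tendsto (fun t : ℕ => W.distribution ξ t) atTop (𝓝 μ)

/-- The walk has a limit distribution with respect to `ξ`. -/
def HasLimitDistribution (W : QuantumWalk H) (ξ : H) : Prop :=
  ∃ μ : FiniteMeasure ℝ, W.IsLimitDistribution ξ μ

end QuantumWalk

/-!
The limit distributions agree because the characteristic functions of the rescaled positions do.
Put `X k = exp (i k D₂) V exp (- i k D₁)`. As `V` intertwines the walks, `V U₁ ^ t ξ = U₂ ^ t V ξ`,
and the characteristic functions at `s` of the two distributions at time `t` differ by
`⟨(X (s / t) - V) exp (i (s / t) D₁) U₁ ^ t ξ, V U₁ ^ t ξ⟩`. This is at most `‖X (s / t) - X 0‖`,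
which tends to `0` because `X` is norm continuous (`IsSimilarityBy.tendsto_charFun_sub`). Lévy's
convergence theorem then transfers a weak limit from one walk to the other.

The vector `V ξ` is smooth because `exp (i k D₂) V ξ = X k (exp (i k D₁) ξ)` and a vector is smooth
exactly when its orbit under the unitary group is a smooth curve
(`IsSpectralMeasureOf.isSmoothVector_iff_contDiff`). The latter follows by induction from Stone's
theorem: `ξ` lies in the domain of `D` if and only if `k ↦ exp (i k D) ξ` is differentiable, and the
derivative is `exp (i k D) (i D ξ)`. One direction is dominated convergence in the bounded Borel
calculus of a projection-valued measure, the other is Fatou's lemma.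

All this concerns the spectral measure of `D`, so that the spectral theorem for unbounded
self-adjoint operators is needed (`exists_isSpectralMeasureOf`). The resolvent `R = (D + i)⁻¹` is a
bounded normal operator. The continuous functional calculus of `R` and the Riesz-Markov-Kakutani
theorem give every vector a scalar measure on the spectrum of `R`. The map `f ↦ f(R) ξ` extends
isometrically to `L²` of that measure, and the images of the indicator functions are the spectral
projections. The relation `R - R* = - 2 i R* R` confines the spectrum to `0`, which carries no mass,
and to points `1 / (x + i)` with `x` real; transporting the projections along this parametrization
gives the spectral measure of `D`.
-/

/-! ### Bounded Borel functional calculus of a projection-valued measure -/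

section QuadraticForms

variable {H : Type*} [NormedAddCommGroup H] [InnerProductSpace ℂ H]

theorem ContinuousLinearMap.eq_of_inner_self_eq {A B : H →L[ℂ] H}
    (h : ∀ ξ, inner ℂ ξ (A ξ) = inner ℂ ξ (B ξ)) : A = B := by
  have h1 := (ext_inner_map (A : H →ₗ[ℂ] H) (B : H →ₗ[ℂ] H)).1 fun x => by
    have := congrArg (starRingEnd ℂ) (h x)
    simp only [inner_conj_symm] at this
    exact this
  ext x
  exact LinearMap.congr_fun h1 x

theorem inner_self_eq_norm_sq_complex (ξ : H) : inner ℂ ξ ξ = ((‖ξ‖ ^ 2 : ℝ) : ℂ) := by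
  rw [inner_self_eq_norm_sq_to_K]; simp

end QuadraticForms

/-- A bounded Borel function on the real line. -/
structure IsBoundedBorel (f : ℝ → ℂ) : Prop where
  measurable : Measurable f
  bounded : ∃ C : ℝ, ∀ x, ‖f x‖ ≤ C

namespace IsBoundedBorel

variable {f g : ℝ → ℂ}

theorem const (c : ℂ) : IsBoundedBorel fun _ => c := ⟨measurable_const, ‖c‖, fun _ => le_rfl⟩

theorem add (hf : IsBoundedBorel f) (hg : IsBoundedBorel g) :
    IsBoundedBorel fun x => f x + g x := by
  obtain ⟨C, hC⟩ := hf.bounded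
  obtain ⟨C', hC'⟩ := hg.bounded
  exact ⟨hf.measurable.add hg.measurable, C + C', fun x =>
    (norm_add_le _ _).trans (add_le_add (hC x) (hC' x))⟩

theorem mul (hf : IsBoundedBorel f) (hg : IsBoundedBorel g) :
    IsBoundedBorel fun x => f x * g x := by
  obtain ⟨C, hC⟩ := hf.bounded
  obtain ⟨C', hC'⟩ := hg.bounded
  exact ⟨hf.measurable.mul hg.measurable, C * C', fun x => (norm_mul_le _ _).trans
    (mul_le_mul (hC x) (hC' x) (norm_nonneg _) ((norm_nonneg _).trans (hC x)))⟩

theorem sub (hf : IsBoundedBorel f) (hg : IsBoundedBorel g) :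
    IsBoundedBorel fun x => f x - g x := by
  simpa [sub_eq_add_neg] using hf.add ((const (-1)).mul hg)

theorem conj (hf : IsBoundedBorel f) : IsBoundedBorel fun x => starRingEnd ℂ (f x) := by
  obtain ⟨C, hC⟩ := hf.bounded
  exact ⟨Complex.continuous_conj.measurable.comp hf.measurable, C, fun x => by simpa using hC x⟩

theorem indicator (hf : IsBoundedBorel f) {B : Set ℝ} (hB : MeasurableSet B) :
    IsBoundedBorel (B.indicator f) := by
  obtain ⟨C, hC⟩ := hf.bounded
  exact ⟨hf.measurable.indicator hB, C, fun x => (norm_indicator_le_norm_self f x).trans (hC x)⟩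

theorem indicator_one {B : Set ℝ} (hB : MeasurableSet B) :
    IsBoundedBorel (B.indicator (1 : ℝ → ℂ)) :=
  IsBoundedBorel.indicator (const 1) hB

theorem integrable (hf : IsBoundedBorel f) (μ : Measure ℝ) [IsFiniteMeasure μ] :
    Integrable f μ := by
  obtain ⟨C, hC⟩ := hf.bounded
  exact Integrable.of_bound hf.measurable.aestronglyMeasurable C (Eventually.of_forall hC)

theorem norm_exp (k x : ℝ) : ‖Complex.exp (Complex.I * k * x)‖ = 1 := by
  have : Complex.I * k * x = ((k * x : ℝ) : ℂ) * Complex.I := by push_cast; ring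
  rw [this, Complex.norm_exp_ofReal_mul_I]

theorem exp (k : ℝ) : IsBoundedBorel fun x : ℝ => Complex.exp (Complex.I * k * x) :=
  ⟨by fun_prop, 1, fun x => (norm_exp k x).le⟩

end IsBoundedBorel

namespace ProjectionValuedMeasure

variable {H : Type*} [NormedAddCommGroup H] [InnerProductSpace ℂ H] [CompleteSpace H]
variable (E : ProjectionValuedMeasure H) {f g : ℝ → ℂ}

/-- The operator `∫ f dE` for a bounded Borel function `f`, characterized by its quadratic form
`⟨A ξ, ξ⟩ = ∫ f(x) ⟨E(dx) ξ, ξ⟩`. The value has no meaning for other functions `f`. -/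
noncomputable def calculus (f : ℝ → ℂ) : H →L[ℂ] H :=
  Classical.epsilon fun A => ∀ ξ : H, inner ℂ ξ (A ξ) = ∫ x, f x ∂(E.measure ξ)

theorem inner_calculus (hf : IsBoundedBorel f) (ξ : H) :
    inner ℂ ξ (E.calculus f ξ) = ∫ x, f x ∂(E.measure ξ) := by
  obtain ⟨C, hC⟩ := hf.bounded
  exact Classical.epsilon_spec (E.exists_integral f hf.measurable C hC) ξ

theorem calculus_eq (hf : IsBoundedBorel f) {A : H →L[ℂ] H}
    (hA : ∀ ξ, inner ℂ ξ (A ξ) = ∫ x, f x ∂(E.measure ξ)) : E.calculus f = A :=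
  ContinuousLinearMap.eq_of_inner_self_eq fun ξ => by rw [hA, E.inner_calculus hf]

theorem expI_eq_calculus (k : ℝ) :
    E.expI k = E.calculus fun x => Complex.exp (Complex.I * k * x) :=
  (E.calculus_eq (.exp k) (E.inner_expI k)).symm

theorem measureReal_univ (ξ : H) : (E.measure ξ).real Set.univ = ‖ξ‖ ^ 2 := by
  rw [Measure.real, E.measure_univ, ENNReal.toReal_ofReal (by positivity)]

theorem measureReal_eq_norm_sq (ξ : H) {B : Set ℝ} (hB : MeasurableSet B) :
    (E.measure ξ).real B = ‖E.proj B ξ‖ ^ 2 := by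
  have := E.measureReal_eq ξ hB
  rw [E.inner_proj hB] at this
  exact_mod_cast this

theorem measure_eq_norm_sq (ξ : H) {B : Set ℝ} (hB : MeasurableSet B) :
    E.measure ξ B = ENNReal.ofReal (‖E.proj B ξ‖ ^ 2) := by
  rw [← E.measureReal_eq_norm_sq ξ hB, ofReal_measureReal]

theorem calculus_const (c : ℂ) : E.calculus (fun _ => c) = c • (1 : H →L[ℂ] H) :=
  E.calculus_eq (.const c) fun ξ => by
    rw [integral_const, E.measureReal_univ]
    simp [mul_comm]

theorem calculus_add (hf : IsBoundedBorel f) (hg : IsBoundedBorel g) :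
    E.calculus (fun x => f x + g x) = E.calculus f + E.calculus g :=
  E.calculus_eq (hf.add hg) fun ξ => by
    rw [integral_add (hf.integrable _) (hg.integrable _), _root_.add_apply, inner_add_right,
      E.inner_calculus hf, E.inner_calculus hg]

theorem calculus_const_mul (c : ℂ) (hf : IsBoundedBorel f) :
    E.calculus (fun x => c * f x) = c • E.calculus f :=
  E.calculus_eq ((IsBoundedBorel.const c).mul hf) fun ξ => by
    rw [integral_const_mul, _root_.smul_apply, inner_smul_right, E.inner_calculus hf]

theorem calculus_sub (hf : IsBoundedBorel f) (hg : IsBoundedBorel g) :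
    E.calculus (fun x => f x - g x) = E.calculus f - E.calculus g :=
  E.calculus_eq (hf.sub hg) fun ξ => by
    rw [integral_sub (hf.integrable _) (hg.integrable _), _root_.sub_apply, inner_sub_right,
      E.inner_calculus hf, E.inner_calculus hg]

theorem calculus_conj (hf : IsBoundedBorel f) :
    E.calculus (fun x => starRingEnd ℂ (f x)) = ContinuousLinearMap.adjoint (E.calculus f) :=
  E.calculus_eq hf.conj fun ξ => by
    rw [ContinuousLinearMap.adjoint_inner_right, ← inner_conj_symm, E.inner_calculus hf,
      integral_conj]

theorem calculus_indicator_one {B : Set ℝ} (hB : MeasurableSet B) :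
    E.calculus (B.indicator 1) = E.proj B :=
  E.calculus_eq (.indicator_one hB) fun ξ => by
    rw [integral_indicator hB, ← E.measureReal_eq ξ hB]
    simp

theorem norm_calculus_le (hf : IsBoundedBorel f) {C : ℝ} (hC : ∀ x, ‖f x‖ ≤ C) :
    ‖E.calculus f‖ ≤ 2 * C := by
  refine norm_le_of_quadratic_bound _ _ ((norm_nonneg _).trans (hC 0)) fun ξ => ?_
  rw [E.inner_calculus hf, ← E.measureReal_univ]
  exact norm_integral_le_of_norm_le_const (Eventually.of_forall hC)

theorem proj_proj_self {B : Set ℝ} (hB : MeasurableSet B) (ξ : H) :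
    E.proj B (E.proj B ξ) = E.proj B ξ := by
  simpa using congrArg (fun A : H →L[ℂ] H => A ξ) (E.isStarProjection_proj B hB).isIdempotentElem.eq

theorem inner_proj_left {B : Set ℝ} (hB : MeasurableSet B) (ξ η : H) :
    inner ℂ (E.proj B ξ) η = inner ℂ ξ (E.proj B η) := by
  have h : ContinuousLinearMap.adjoint (E.proj B) = E.proj B :=
    (E.isStarProjection_proj B hB).isSelfAdjoint
  conv_lhs => rw [← h]
  rw [ContinuousLinearMap.adjoint_inner_left]

theorem proj_union {B C : Set ℝ} (hB : MeasurableSet B) (hC : MeasurableSet C)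
    (h : Disjoint B C) : E.proj (B ∪ C) = E.proj B + E.proj C :=
  ContinuousLinearMap.eq_of_inner_self_eq fun ξ => by
    rw [_root_.add_apply, inner_add_right, ← E.measureReal_eq ξ hB, ← E.measureReal_eq ξ hC,
      ← E.measureReal_eq ξ (hB.union hC), measureReal_union h hC]
    push_cast; rfl

theorem proj_proj_of_disjoint {B C : Set ℝ} (hB : MeasurableSet B) (hC : MeasurableSet C)
    (h : Disjoint B C) (ξ : H) : E.proj B (E.proj C ξ) = 0 := by
  -- `E(B) + E(C) = E(B ∪ C) ≤ 1` leaves no room for `E(B)` on the range of `E(C)`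
  have h1 : (E.measure (E.proj C ξ)).real (B ∪ C) ≤ ‖E.proj C ξ‖ ^ 2 := by
    rw [← E.measureReal_univ]; exact measureReal_mono (Set.subset_univ _)
  rw [measureReal_union h hC, E.measureReal_eq_norm_sq _ hB, E.measureReal_eq_norm_sq _ hC,
    E.proj_proj_self hC] at h1
  have : ‖E.proj B (E.proj C ξ)‖ ^ 2 = 0 := le_antisymm (by linarith) (by positivity)
  simpa using this

theorem proj_proj {B C : Set ℝ} (hB : MeasurableSet B) (hC : MeasurableSet C) (ξ : H) :
    E.proj B (E.proj C ξ) = E.proj (B ∩ C) ξ := by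
  have h1 := E.proj_union (hB.inter hC) (hC.diff hB)
    (Set.disjoint_left.2 fun x hx hx' => hx'.2 hx.1)
  have h2 := E.proj_union (hB.inter hC) (hB.diff hC)
    (Set.disjoint_left.2 fun x hx hx' => hx'.2 hx.2)
  rw [Set.inter_comm, Set.inter_union_sdiff] at h1
  rw [Set.inter_union_sdiff] at h2
  rw [h1, _root_.add_apply, map_add,
    E.proj_proj_of_disjoint hB (hC.diff hB) (Set.disjoint_left.2 fun x hx hx' => hx'.2 hx),
    add_zero, Set.inter_comm, h2, _root_.add_apply, E.proj_proj_self (hB.inter hC),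
    E.proj_proj_of_disjoint (hB.diff hC) (hB.inter hC)
      (Set.disjoint_left.2 fun x hx hx' => hx.2 hx'.2), add_zero]

theorem measure_proj {B : Set ℝ} (hB : MeasurableSet B) (ξ : H) :
    E.measure (E.proj B ξ) = (E.measure ξ).restrict B := by
  ext A hA
  rw [Measure.restrict_apply hA, E.measure_eq_norm_sq _ hA, E.proj_proj hA hB,
    E.measure_eq_norm_sq _ (hA.inter hB)]

/-- The compression of `∫ f dE` to the range of `E(B)` has the quadratic form of `∫_B f dE`, because
the measure of `E(B) ξ` is the restriction to `B` of that of `ξ`. -/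
theorem proj_comp_calculus_comp_proj (hf : IsBoundedBorel f) {B : Set ℝ} (hB : MeasurableSet B) :
    E.proj B ∘L E.calculus f ∘L E.proj B = E.calculus (B.indicator f) :=
  (E.calculus_eq (hf.indicator hB) fun ξ => by
    simp only [ContinuousLinearMap.comp_apply]
    rw [← E.inner_proj_left hB, E.inner_calculus hf, E.measure_proj hB, integral_indicator hB]).symm

theorem calculus_proj (hf : IsBoundedBorel f) {B : Set ℝ} (hB : MeasurableSet B) (ξ : H) :
    E.calculus f (E.proj B ξ) = E.calculus (B.indicator f) ξ := by
  -- `∫ f dE` is block diagonal for `E(B)` and `E(Bᶜ)`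
  have h : E.calculus f = E.calculus (B.indicator f) + E.calculus (Bᶜ.indicator f) := by
    rw [← E.calculus_add (hf.indicator hB) (hf.indicator hB.compl)]
    congr 1
    exact (Set.indicator_self_add_compl B f).symm
  rw [h, ← E.proj_comp_calculus_comp_proj hf hB, ← E.proj_comp_calculus_comp_proj hf hB.compl]
  simp only [_root_.add_apply, ContinuousLinearMap.comp_apply]
  rw [E.proj_proj_self hB, E.proj_proj_of_disjoint hB.compl hB disjoint_compl_left]
  simp

theorem calculus_mul_simpleFunc (hf : IsBoundedBorel f) (s : SimpleFunc ℝ ℂ) :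
    E.calculus (fun x => f x * s x) = E.calculus f ∘L E.calculus s := by
  have hs : ∀ s : SimpleFunc ℝ ℂ, IsBoundedBorel s := fun s =>
    ⟨s.measurable, s.exists_forall_norm_le⟩
  induction s using SimpleFunc.induction with
  | const c hB =>
    rename_i B
    have h1 : (⇑(SimpleFunc.piecewise B hB (SimpleFunc.const ℝ c) (SimpleFunc.const ℝ 0)) : ℝ → ℂ)
        = fun x => c * B.indicator 1 x := by
      ext x; by_cases hx : x ∈ B <;> simp [hx]
    have h2 : (fun x => f x * (c * B.indicator 1 x)) = fun x => c * B.indicator f x := by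
      ext x; by_cases hx : x ∈ B <;> simp [hx, mul_comm]
    rw [h1, h2, E.calculus_const_mul _ (hf.indicator hB),
      E.calculus_const_mul _ (.indicator_one hB), E.calculus_indicator_one hB]
    ext ξ
    simp [E.calculus_proj hf hB]
  | add hd h1 h2 =>
    rename_i s t
    have e : (fun x => f x * (s + t) x) = fun x => f x * s x + f x * t x := by
      ext x; simp [mul_add]
    rw [e, E.calculus_add (hf.mul (hs s)) (hf.mul (hs t)), h1, h2]
    have e2 : (⇑(s + t) : ℝ → ℂ) = fun x => s x + t x := rfl
    rw [e2, E.calculus_add (hs s) (hs t), ContinuousLinearMap.comp_add]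

/-- The calculus is multiplicative: uniform approximation of the second factor reduces this to
simple functions. -/
theorem calculus_mul (hf : IsBoundedBorel f) (hg : IsBoundedBorel g) :
    E.calculus (fun x => f x * g x) = E.calculus f ∘L E.calculus g := by
  obtain ⟨C, hC⟩ := hf.bounded
  obtain ⟨C', hC'⟩ := hg.bounded
  have hC0 : 0 ≤ C := (norm_nonneg _).trans (hC 0)
  rw [← sub_eq_zero, ← norm_le_zero_iff]
  refine le_of_forall_pos_le_add fun ε hε => ?_
  obtain ⟨s, hs⟩ := exists_simpleFunc_near g hg.measurable C' hC' (ε / (6 * C + 1)) (by positivity)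
  have hsb : IsBoundedBorel s := ⟨s.measurable, s.exists_forall_norm_le⟩
  have e : E.calculus (fun x => f x * g x) - E.calculus f ∘L E.calculus g
      = E.calculus (fun x => f x * (g x - s x))
        - E.calculus f ∘L E.calculus (fun x => g x - s x) := by
    have : (fun x => f x * (g x - s x)) = fun x => f x * g x - f x * s x := by ext; ring
    rw [this, E.calculus_sub (hf.mul hg) (hf.mul hsb), E.calculus_sub hg hsb,
      E.calculus_mul_simpleFunc hf, ContinuousLinearMap.comp_sub]
    abel
  have b1 : ‖E.calculus (fun x => f x * (g x - s x))‖ ≤ 2 * (C * (ε / (6 * C + 1))) :=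
    E.norm_calculus_le (hf.mul (hg.sub hsb)) fun x => (norm_mul_le _ _).trans
      (mul_le_mul (hC x) (hs x) (norm_nonneg _) hC0)
  have b2 := E.norm_calculus_le (hg.sub hsb) hs
  have b3 := E.norm_calculus_le hf hC
  have b4 := (ContinuousLinearMap.opNorm_comp_le (E.calculus f)
    (E.calculus (fun x => g x - s x))).trans (mul_le_mul b3 b2 (norm_nonneg _) (by positivity))
  have b5 : 6 * C * (ε / (6 * C + 1)) ≤ ε := by
    rw [mul_div_assoc', div_le_iff₀ (by positivity)]
    nlinarith
  rw [e, zero_add]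
  refine (norm_sub_le _ _).trans ?_
  linarith

theorem norm_calculus_sq (hf : IsBoundedBorel f) (ξ : H) :
    ‖E.calculus f ξ‖ ^ 2 = ∫ x, ‖f x‖ ^ 2 ∂(E.measure ξ) := by
  have h : inner ℂ (E.calculus f ξ) (E.calculus f ξ)
      = ∫ x, ((‖f x‖ ^ 2 : ℝ) : ℂ) ∂(E.measure ξ) := by
    rw [← ContinuousLinearMap.adjoint_inner_right, ← E.calculus_conj hf,
      ← ContinuousLinearMap.comp_apply, ← E.calculus_mul hf.conj hf,
      E.inner_calculus (hf.conj.mul hf)]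
    simp only [Complex.conj_mul', Complex.ofReal_pow]
  rw [inner_self_eq_norm_sq_complex, integral_complex_ofReal] at h
  exact_mod_cast h

theorem proj_calculus (hf : IsBoundedBorel f) {B : Set ℝ} (hB : MeasurableSet B) (ξ : H) :
    E.proj B (E.calculus f ξ) = E.calculus (B.indicator f) ξ := by
  rw [← E.calculus_indicator_one hB, ← ContinuousLinearMap.comp_apply,
    ← E.calculus_mul (.indicator_one hB) hf]
  congr 2
  ext x; by_cases hx : x ∈ B <;> simp [hx]

/-- The scalar measure of `(∫ f dE) ξ` has density `|f|²` with respect to that of `ξ`. -/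
theorem measure_calculus (hf : IsBoundedBorel f) (ξ : H) :
    E.measure (E.calculus f ξ)
      = (E.measure ξ).withDensity fun x => ((‖f x‖₊ ^ 2 : NNReal) : ENNReal) := by
  ext B hB
  rw [E.measure_eq_norm_sq _ hB, E.proj_calculus hf hB, E.norm_calculus_sq (hf.indicator hB),
    withDensity_apply _ hB]
  have h1 : ∀ x, ‖B.indicator f x‖ ^ 2 = B.indicator (fun x => ‖f x‖ ^ 2) x := fun x => by
    by_cases hx : x ∈ B <;> simp [hx]
  simp only [h1]
  have h2 : Integrable (fun x => ‖f x‖ ^ 2) ((E.measure ξ).restrict B) := by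
    obtain ⟨C, hC⟩ := hf.bounded
    refine Integrable.of_bound (hf.measurable.norm.pow_const 2).aestronglyMeasurable (C ^ 2)
      (Eventually.of_forall fun x => ?_)
    rw [norm_pow, norm_norm]
    exact pow_le_pow_left₀ (norm_nonneg _) (hC x) 2
  rw [integral_indicator hB, ofReal_integral_eq_lintegral_ofReal h2
    (Eventually.of_forall fun x => by positivity)]
  refine lintegral_congr fun x => ?_
  rw [ENNReal.ofReal, Real.toNNReal_pow (norm_nonneg _), norm_toNNReal]

theorem integral_measure_calculus {F : Type*} [NormedAddCommGroup F] [NormedSpace ℝ F]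
    (hf : IsBoundedBorel f) (ξ : H) (u : ℝ → F) :
    ∫ x, u x ∂(E.measure (E.calculus f ξ)) = ∫ x, ‖f x‖ ^ 2 • u x ∂(E.measure ξ) := by
  rw [E.measure_calculus hf,
    integral_withDensity_eq_integral_smul (hf.measurable.nnnorm.pow_const 2)]
  rfl

theorem integrable_measure_calculus {F : Type*} [NormedAddCommGroup F] [NormedSpace ℝ F]
    (hf : IsBoundedBorel f) (ξ : H) (u : ℝ → F) :
    Integrable u (E.measure (E.calculus f ξ))
      ↔ Integrable (fun x => ‖f x‖ ^ 2 • u x) (E.measure ξ) := by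
  rw [E.measure_calculus hf,
    integrable_withDensity_iff_integrable_smul (hf.measurable.nnnorm.pow_const 2)]
  rfl

theorem tendsto_calculus {ι : Type*} {l : Filter ι} [l.IsCountablyGenerated]
    {F : ι → ℝ → ℂ} (hF : ∀ i, IsBoundedBorel (F i)) (hf : IsBoundedBorel f) {C : ℝ}
    (hC : ∀ i x, ‖F i x‖ ≤ C) (hlim : ∀ x, Tendsto (fun i => F i x) l (𝓝 (f x))) (ξ : H) :
    Tendsto (fun i => E.calculus (F i) ξ) l (𝓝 (E.calculus f ξ)) := by
  obtain ⟨C', hC'⟩ := hf.bounded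
  have h1 : ∀ i, ‖E.calculus (F i) ξ - E.calculus f ξ‖
      = √(∫ x, ‖F i x - f x‖ ^ 2 ∂(E.measure ξ)) := fun i => by
    rw [← E.norm_calculus_sq ((hF i).sub hf), Real.sqrt_sq (norm_nonneg _),
      E.calculus_sub (hF i) hf, _root_.sub_apply]
  have h2 : Tendsto (fun i => ∫ x, ‖F i x - f x‖ ^ 2 ∂(E.measure ξ)) l
      (𝓝 (∫ _, (0 : ℝ) ∂(E.measure ξ))) := by
    refine tendsto_integral_filter_of_dominated_convergence (fun _ => (C + C') ^ 2)
      (Eventually.of_forall fun i =>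
        (((hF i).sub hf).measurable.norm.pow_const 2).aestronglyMeasurable)
      (Eventually.of_forall fun i => Eventually.of_forall fun x => ?_) (integrable_const _)
      (Eventually.of_forall fun x => ?_)
    · rw [norm_pow, norm_norm]
      exact pow_le_pow_left₀ (norm_nonneg _)
        ((norm_sub_le _ _).trans (add_le_add (hC i x) (hC' x))) 2
    · simpa using (((hlim x).sub_const (f x)).norm).pow 2
  rw [tendsto_iff_norm_sub_tendsto_zero]
  simp only [h1]
  have h3 := (Real.continuous_sqrt.tendsto _).comp h2
  simp only [integral_zero, Real.sqrt_zero] at h3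
  exact h3

/-- Dominated convergence for the calculus, with a possibly unbounded limit function: if bounded
Borel functions `F i` converge pointwise and are dominated by a function that is square integrable
for the measure of `ξ`, then the vectors `(∫ F i dE) ξ` converge. -/
theorem exists_tendsto_calculus {ι : Type*} {l : Filter ι} [l.NeBot] [l.IsCountablyGenerated]
    {F : ι → ℝ → ℂ} (hF : ∀ i, IsBoundedBorel (F i)) {f : ℝ → ℂ} {b : ℝ → ℝ} {ξ : H}
    (hb : Integrable (fun x => b x ^ 2) (E.measure ξ)) (hFb : ∀ᶠ i in l, ∀ x, ‖F i x‖ ≤ b x)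
    (hlim : ∀ x, Tendsto (fun i => F i x) l (𝓝 (f x))) :
    ∃ η, Tendsto (fun i => E.calculus (F i) ξ) l (𝓝 η) := by
  refine cauchy_map_iff_exists_tendsto.1 (cauchy_map_iff.2 ⟨inferInstance, ?_⟩)
  rw [Metric.uniformity_eq_comap_nhds_zero, tendsto_comap_iff]
  have h1 : ∀ p : ι × ι, dist (E.calculus (F p.1) ξ) (E.calculus (F p.2) ξ)
      = √(∫ x, ‖F p.1 x - F p.2 x‖ ^ 2 ∂(E.measure ξ)) := fun p => by
    rw [← E.norm_calculus_sq ((hF p.1).sub (hF p.2)), Real.sqrt_sq (norm_nonneg _), dist_eq_norm,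
      E.calculus_sub (hF _) (hF _), _root_.sub_apply]
  have h2 : Tendsto (fun p : ι × ι => ∫ x, ‖F p.1 x - F p.2 x‖ ^ 2 ∂(E.measure ξ)) (l ×ˢ l)
      (𝓝 (∫ _, (0 : ℝ) ∂(E.measure ξ))) := by
    refine tendsto_integral_filter_of_dominated_convergence (fun x => 4 * b x ^ 2)
      (Eventually.of_forall fun p =>
        (((hF p.1).sub (hF p.2)).measurable.norm.pow_const 2).aestronglyMeasurable)
      ?_ (hb.const_mul 4) (Eventually.of_forall fun x => ?_)
    · filter_upwards [hFb.prod_mk hFb] with p hp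
      refine Eventually.of_forall fun x => ?_
      rw [norm_pow, norm_norm]
      have h3 : ‖F p.1 x - F p.2 x‖ ≤ 2 * b x := by
        have := norm_sub_le (F p.1 x) (F p.2 x)
        have := hp.1 x
        have := hp.2 x
        linarith
      calc _ ≤ (2 * b x) ^ 2 := pow_le_pow_left₀ (norm_nonneg _) h3 2
        _ = _ := by ring
    · have h3 := ((((hlim x).comp (tendsto_fst (g := l))).sub
        ((hlim x).comp (tendsto_snd (f := l)))).norm).pow 2
      simpa using h3
  have h4 := (Real.continuous_sqrt.tendsto _).comp h2
  simp only [integral_zero, Real.sqrt_zero] at h4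
  refine h4.congr fun p => ?_
  simp [Function.comp, h1]

end ProjectionValuedMeasure

/-! ### The unitary group of a self-adjoint operator and its smooth vectors -/

section QuadraticForms

variable {H : Type*} [NormedAddCommGroup H] [InnerProductSpace ℂ H]

/-- Polarization for a densely defined operator: it vanishes if its quadratic form does. -/
theorem LinearMap.eq_zero_of_inner_self_eq_zero_of_dense {p : Submodule ℂ H}
    (hp : Dense (p : Set H)) (S : p →ₗ[ℂ] H) (h : ∀ ξ : p, inner ℂ (ξ : H) (S ξ) = 0) :
    S = 0 := by
  ext η
  refine hp.eq_zero_of_inner_right ℂ fun v hv => ?_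
  have h1 := h (⟨v, hv⟩ + η)
  have h2 := h (⟨v, hv⟩ + Complex.I • η)
  have hv' := h ⟨v, hv⟩
  have hη := h η
  simp only [map_add, map_smul, Submodule.coe_add, Submodule.coe_smul, inner_add_left,
    inner_add_right, inner_smul_left, inner_smul_right, Complex.conj_I, hv', hη] at h1 h2
  have h3 : Complex.I * (inner ℂ v (S η) - inner ℂ (η : H) (S ⟨v, hv⟩)) = 0 := by
    linear_combination h2
  have h4 := (mul_eq_zero.1 h3).resolve_left Complex.I_ne_zero
  linear_combination (h1 + h4) / 2

end QuadraticForms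

/-- The difference quotient at `0`, with increment `h`, of `k ↦ exp (i k x)`. -/
noncomputable def expDiffQuotient (h : ℝ) (x : ℝ) : ℂ :=
  (h : ℂ)⁻¹ * (Complex.exp (Complex.I * h * x) - 1)

theorem isBoundedBorel_expDiffQuotient (h : ℝ) : IsBoundedBorel (expDiffQuotient h) :=
  (IsBoundedBorel.const _).mul ((IsBoundedBorel.exp h).sub (.const 1))

theorem norm_expDiffQuotient_le (h x : ℝ) : ‖expDiffQuotient h x‖ ≤ |x| := by
  rcases eq_or_ne h 0 with rfl | hh
  · simp [expDiffQuotient]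
  have h1 := Real.norm_exp_I_mul_ofReal_sub_one_le (x := h * x)
  rw [expDiffQuotient, norm_mul, norm_inv, Complex.norm_real, mul_assoc, ← Complex.ofReal_mul]
  rw [norm_mul] at h1
  rw [inv_mul_le_iff₀ (norm_pos_iff.2 hh)]
  exact h1

theorem tendsto_expDiffQuotient (x : ℝ) :
    Tendsto (fun h => expDiffQuotient h x) (𝓝[≠] 0) (𝓝 (Complex.I * x)) := by
  have h1 : HasDerivAt (fun k : ℝ => Complex.exp (Complex.I * k * x)) (Complex.I * x) 0 := by
    have h2 : HasDerivAt (fun k : ℝ => Complex.I * k * x) (Complex.I * x) 0 := by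
      simpa using ((Complex.ofRealCLM.hasDerivAt (x := (0 : ℝ))).const_mul Complex.I).mul_const
        (x : ℂ)
    simpa using h2.cexp
  have h3 := hasDerivAt_iff_tendsto_slope_zero.1 h1
  refine h3.congr fun h => ?_
  simp [expDiffQuotient]

namespace ProjectionValuedMeasure

variable {H : Type*} [NormedAddCommGroup H] [InnerProductSpace ℂ H] [CompleteSpace H]
variable (E : ProjectionValuedMeasure H)

theorem expI_zero : E.expI 0 = 1 := by
  rw [expI_eq_calculus]
  simp [E.calculus_const]

theorem expI_add (k l : ℝ) : E.expI (k + l) = E.expI k ∘L E.expI l := by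
  simp only [expI_eq_calculus]
  rw [← E.calculus_mul (.exp k) (.exp l)]
  congr 1
  ext x
  rw [← Complex.exp_add]
  congr 1
  push_cast; ring

theorem expI_neg_comp (k : ℝ) : E.expI (-k) ∘L E.expI k = 1 := by
  rw [← E.expI_add, neg_add_cancel, E.expI_zero]

theorem norm_expI_apply (k : ℝ) (ξ : H) : ‖E.expI k ξ‖ = ‖ξ‖ := by
  have h := E.norm_calculus_sq (.exp k) ξ
  simp only [IsBoundedBorel.norm_exp, one_pow, integral_const, smul_eq_mul, mul_one,
    E.measureReal_univ] at h
  rw [expI_eq_calculus]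
  exact (pow_left_inj₀ (norm_nonneg _) (norm_nonneg _) two_ne_zero).1 h

theorem calculus_expDiffQuotient (h : ℝ) :
    E.calculus (expDiffQuotient h) = (h : ℂ)⁻¹ • (E.expI h - 1) := by
  have : E.calculus (fun _ => (1 : ℂ)) = 1 := by rw [E.calculus_const, one_smul]
  rw [expI_eq_calculus, ← this, ← E.calculus_sub (.exp h) (.const 1),
    ← E.calculus_const_mul _ ((IsBoundedBorel.exp h).sub (.const 1))]
  rfl

theorem calculus_expDiffQuotient_apply (h : ℝ) (ξ : H) :
    E.calculus (expDiffQuotient h) ξ = h⁻¹ • (E.expI (0 + h) ξ - E.expI 0 ξ) := by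
  rw [E.calculus_expDiffQuotient, zero_add, E.expI_zero]
  simp only [_root_.smul_apply, _root_.sub_apply, one_apply_eq_self]
  rw [← Complex.ofReal_inv, Complex.coe_smul]

theorem hasDerivAt_expI_apply_of_zero {ξ η : H} (h : HasDerivAt (fun k => E.expI k ξ) η 0) (k : ℝ) :
    HasDerivAt (fun k => E.expI k ξ) (E.expI k η) k := by
  rw [hasDerivAt_iff_tendsto_slope_zero] at h ⊢
  refine (((E.expI k).continuous.tendsto η).comp h).congr fun t => ?_
  simp [E.expI_add k t, E.expI_zero]

theorem continuous_expI_apply (ξ : H) : Continuous fun k => E.expI k ξ := by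
  refine continuous_iff_continuousAt.2 fun k => ?_
  have h := E.tendsto_calculus (l := 𝓝 k) IsBoundedBorel.exp (.exp k) (C := 1)
    (fun l x => (IsBoundedBorel.norm_exp l x).le)
    (fun x => by
      have : Continuous fun l : ℝ => Complex.exp (Complex.I * l * x) := by fun_prop
      exact this.tendsto k) ξ
  simp only [← E.expI_eq_calculus] at h
  exact h

variable {E} {D : H →ₗ.[ℂ] H}

namespace IsSpectralMeasureOf

/-- Half of Stone's theorem. The derivative at `0` exists by dominated convergence, it depends
linearly on the vector, and its quadratic form is that of `i D`. -/
theorem hasDerivAt_expI_zero (hE : E.IsSpectralMeasureOf D) (hD : Dense (D.domain : Set H))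
    (ξ : D.domain) :
    HasDerivAt (fun k => E.expI k (ξ : H)) (Complex.I • D ξ) 0 := by
  have hex : ∀ ξ : D.domain, ∃ η,
      Tendsto (fun h => E.calculus (expDiffQuotient h) (ξ : H)) (𝓝[≠] 0) (𝓝 η) := fun ξ =>
    E.exists_tendsto_calculus isBoundedBorel_expDiffQuotient (b := fun x => |x|)
      (by simpa using (hE.1 ξ).1 ξ.2) (Eventually.of_forall norm_expDiffQuotient_le)
      tendsto_expDiffQuotient
  choose L hL using hex
  let S : D.domain →ₗ[ℂ] H :=
    { toFun := fun ξ => L ξ - Complex.I • D ξ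
      map_add' := fun ξ η => by
        have := tendsto_nhds_unique (hL (ξ + η))
          (((hL ξ).add (hL η)).congr fun h => by simp)
        rw [this, D.map_add, smul_add]; abel
      map_smul' := fun c ξ => by
        have := tendsto_nhds_unique (hL (c • ξ)) (((hL ξ).const_smul c).congr fun h => by simp)
        rw [this, D.map_smul, smul_comm, RingHom.id_apply, smul_sub] }
  have hS : S = 0 := LinearMap.eq_zero_of_inner_self_eq_zero_of_dense hD S fun ξ => by
    have hx : Integrable (fun x : ℝ => |x|) (E.measure (ξ : H)) := by
      have h2 : MemLp (fun x : ℝ => x) 2 (E.measure (ξ : H)) :=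
        (memLp_two_iff_integrable_sq measurable_id.aestronglyMeasurable).2 ((hE.1 ξ).1 ξ.2)
      exact (h2.integrable one_le_two).abs
    have h1 : Tendsto (fun h => inner ℂ (ξ : H) (E.calculus (expDiffQuotient h) (ξ : H))) (𝓝[≠] 0)
        (𝓝 (∫ x : ℝ, Complex.I * x ∂(E.measure (ξ : H)))) := by
      simp only [E.inner_calculus (isBoundedBorel_expDiffQuotient _)]
      refine tendsto_integral_filter_of_dominated_convergence (fun x => |x|)
        (Eventually.of_forall fun h =>
          (isBoundedBorel_expDiffQuotient h).measurable.aestronglyMeasurable)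
        (Eventually.of_forall fun h => Eventually.of_forall (norm_expDiffQuotient_le h)) hx
        (Eventually.of_forall tendsto_expDiffQuotient)
    have h2 := tendsto_nhds_unique (tendsto_const_nhds.inner (hL ξ)) h1
    rw [integral_const_mul, integral_complex_ofReal, ← hE.2 ξ] at h2
    change inner ℂ (ξ : H) (L ξ - Complex.I • D ξ) = 0
    rw [inner_sub_right, h2, inner_smul_right, sub_self]
  have h3 : L ξ = Complex.I • D ξ := sub_eq_zero.1 (LinearMap.congr_fun hS ξ)
  rw [hasDerivAt_iff_tendsto_slope_zero, ← h3]
  exact (hL ξ).congr fun h => E.calculus_expDiffQuotient_apply h ξ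

/-- The other half of Stone's theorem, by Fatou's lemma. -/
theorem mem_domain_of_differentiableAt (hE : E.IsSpectralMeasureOf D) {ξ : H}
    (h : DifferentiableAt ℝ (fun k => E.expI k ξ) 0) : ξ ∈ D.domain := by
  rw [hE.1]
  have h1 := hasDerivAt_iff_tendsto_slope_zero.1 h.hasDerivAt
  set η := deriv (fun k => E.expI k ξ) 0
  have hint : ∀ h, Integrable (fun x => ‖expDiffQuotient h x‖ ^ 2) (E.measure ξ) := fun h => by
    have hb := isBoundedBorel_expDiffQuotient h
    simpa using (E.integrable_measure_calculus hb ξ (fun _ => (1 : ℝ))).1 (integrable_const _)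
  have hlim : ∀ x : ℝ, Tendsto (fun h => ‖expDiffQuotient h x‖ ^ 2) (𝓝[≠] 0) (𝓝 (x ^ 2)) :=
    fun x => by simpa using (tendsto_expDiffQuotient x).norm.pow 2
  have hseq : Tendsto (fun n : ℕ => 1 / ((n : ℝ) + 1)) atTop (𝓝[≠] 0) :=
    tendsto_nhdsWithin_iff.2 ⟨tendsto_one_div_add_atTop_nhds_zero_nat,
      Eventually.of_forall fun n => by
        have : (0 : ℝ) < 1 / ((n : ℝ) + 1) := by positivity
        exact this.ne'⟩
  refine integrable_of_tendsto (G := fun (n : ℕ) x => ‖expDiffQuotient (1 / ((n : ℝ) + 1)) x‖ ^ 2)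
    (Eventually.of_forall fun x => (hlim x).comp hseq) (fun n => (hint _).aestronglyMeasurable) ?_
  have h2 : Tendsto (fun n : ℕ => ENNReal.ofReal
      (‖E.calculus (expDiffQuotient (1 / ((n : ℝ) + 1))) ξ‖ ^ 2)) atTop
      (𝓝 (ENNReal.ofReal (‖η‖ ^ 2))) := by
    refine (ENNReal.continuous_ofReal.tendsto _).comp ((Tendsto.norm ?_).pow 2)
    simp only [E.calculus_expDiffQuotient_apply]
    exact h1.comp hseq
  have h3 : ∀ n : ℕ, ∫⁻ x, ‖‖expDiffQuotient (1 / ((n : ℝ) + 1)) x‖ ^ 2‖ₑ ∂(E.measure ξ)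
      = ENNReal.ofReal (‖E.calculus (expDiffQuotient (1 / ((n : ℝ) + 1))) ξ‖ ^ 2) := fun n => by
    rw [E.norm_calculus_sq (isBoundedBorel_expDiffQuotient _),
      ofReal_integral_eq_lintegral_ofReal (hint _) (Eventually.of_forall fun x => by positivity)]
    refine lintegral_congr fun x => ?_
    rw [Real.enorm_of_nonneg (by positivity)]
  simp only [h3]
  rw [h2.liminf_eq]
  exact ENNReal.ofReal_ne_top

theorem hasDerivAt_expI (hE : E.IsSpectralMeasureOf D) (hD : Dense (D.domain : Set H))
    (ξ : D.domain) (k : ℝ) :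
    HasDerivAt (fun k => E.expI k (ξ : H)) (E.expI k (Complex.I • D ξ)) k :=
  E.hasDerivAt_expI_apply_of_zero (hE.hasDerivAt_expI_zero hD ξ) k

theorem contDiff_of_memDomainPow (hE : E.IsSpectralMeasureOf D) (hD : Dense (D.domain : Set H))
    (m : ℕ) : ∀ ξ : H, MemDomainPow D m ξ → ContDiff ℝ m fun k => E.expI k ξ := by
  induction m with
  | zero => exact fun ξ _ => contDiff_zero.2 (E.continuous_expI_apply ξ)
  | succ m ih =>
    rintro ξ ⟨hξ, h⟩
    have hd := hE.hasDerivAt_expI hD ⟨ξ, hξ⟩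
    push_cast
    refine contDiff_succ_iff_deriv.2 ⟨fun k => (hd k).differentiableAt, by simp, ?_⟩
    rw [funext fun k => (hd k).deriv]
    simp only [map_smul]
    exact (ih _ h).const_smul Complex.I

theorem memDomainPow_of_contDiff (hE : E.IsSpectralMeasureOf D) (hD : Dense (D.domain : Set H))
    (m : ℕ) : ∀ ξ : H, (ContDiff ℝ m fun k => E.expI k ξ) → MemDomainPow D m ξ := by
  induction m with
  | zero => exact fun ξ _ => trivial
  | succ m ih =>
    intro ξ h
    push_cast at h
    have hξ := hE.mem_domain_of_differentiableAt (h.differentiable (by simp)).differentiableAt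
    refine ⟨hξ, ih _ ?_⟩
    have h1 := (contDiff_succ_iff_deriv.1 h).2.2
    rw [funext fun k => (hE.hasDerivAt_expI hD ⟨ξ, hξ⟩ k).deriv] at h1
    simpa [smul_smul] using h1.const_smul (-Complex.I)

theorem isSmoothVector_iff_contDiff (hE : E.IsSpectralMeasureOf D)
    (hD : Dense (D.domain : Set H)) (ξ : H) :
    IsSmoothVector D ξ ↔ ContDiff ℝ ∞ fun k => E.expI k ξ := by
  rw [contDiff_infty]
  exact ⟨fun h m => hE.contDiff_of_memDomainPow hD m ξ (h m),
    fun h m => hE.memDomainPow_of_contDiff hD m ξ (h m)⟩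

end IsSpectralMeasureOf

end ProjectionValuedMeasure

/-! ### The resolvent of a self-adjoint operator at `± i` -/

namespace LinearPMap

variable {H : Type*} [NormedAddCommGroup H] [InnerProductSpace ℂ H] [CompleteSpace H]
variable {D : H →ₗ.[ℂ] H}

theorem inner_apply_comm_of_isSelfAdjoint (hD : IsSelfAdjoint D) (ξ η : D.domain) :
    inner ℂ (D ξ) (η : H) = inner ℂ (ξ : H) (D η) := by
  have h := adjoint_isFormalAdjoint hD.dense_domain
  rw [isSelfAdjoint_def.1 hD] at h
  exact h ξ η

theorem norm_apply_add_smul_sq (hD : IsSelfAdjoint D) {c : ℂ} (hc : starRingEnd ℂ c = -c)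
    (hc1 : ‖c‖ = 1) (ξ : D.domain) :
    ‖D ξ + c • (ξ : H)‖ ^ 2 = ‖D ξ‖ ^ 2 + ‖(ξ : H)‖ ^ 2 := by
  have h : ((‖D ξ + c • (ξ : H)‖ ^ 2 : ℝ) : ℂ) = ((‖D ξ‖ ^ 2 + ‖(ξ : H)‖ ^ 2 : ℝ) : ℂ) := by
    have h1 : c * starRingEnd ℂ c = 1 := by rw [Complex.mul_conj']; simp [hc1]
    rw [← inner_self_eq_norm_sq_complex, Complex.ofReal_add, ← inner_self_eq_norm_sq_complex,
      ← inner_self_eq_norm_sq_complex]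
    simp only [inner_add_left, inner_add_right, inner_smul_left, inner_smul_right,
      inner_apply_comm_of_isSelfAdjoint hD]
    rw [hc] at h1 ⊢
    linear_combination (inner ℂ (ξ : H) (ξ : H)) * h1
  exact_mod_cast h

/-- The map `ξ ↦ D ξ + c ξ` on the domain of `D`. -/
noncomputable def addSmul (D : H →ₗ.[ℂ] H) (c : ℂ) : D.domain →ₗ[ℂ] H :=
  D.toFun + c • D.domain.subtype

omit [CompleteSpace H] in
theorem addSmul_apply (c : ℂ) (ξ : D.domain) : D.addSmul c ξ = D ξ + c • (ξ : H) := rfl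

theorem norm_le_norm_addSmul (hD : IsSelfAdjoint D) {c : ℂ} (hc : starRingEnd ℂ c = -c)
    (hc1 : ‖c‖ = 1) (ξ : D.domain) : ‖(ξ : H)‖ ≤ ‖D.addSmul c ξ‖ := by
  refine (pow_le_pow_iff_left₀ (norm_nonneg _) (norm_nonneg _) two_ne_zero).1 ?_
  rw [addSmul_apply, norm_apply_add_smul_sq hD hc hc1]
  linarith [sq_nonneg ‖D ξ‖]

theorem isClosed_range_addSmul (hD : IsSelfAdjoint D) {c : ℂ} (hc : starRingEnd ℂ c = -c)
    (hc1 : ‖c‖ = 1) : _root_.IsClosed (LinearMap.range (D.addSmul c) : Set H) := by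
  refine isClosed_of_closure_subset fun y hy => ?_
  obtain ⟨u, hu, hlim⟩ := mem_closure_iff_seq_limit.1 hy
  choose x hx using hu
  -- `D + c` expands distances, so preimages of a Cauchy sequence form one; `D` is closed
  have hcau : CauchySeq fun n => (x n : H) := by
    refine Metric.cauchySeq_iff.2 fun ε hε => ?_
    obtain ⟨N, hN⟩ := Metric.cauchySeq_iff.1 hlim.cauchySeq ε hε
    refine ⟨N, fun m hm n hn => lt_of_le_of_lt ?_ (hN m hm n hn)⟩
    rw [dist_eq_norm, dist_eq_norm, ← hx m, ← hx n, ← _root_.map_sub]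
    exact norm_le_norm_addSmul hD hc hc1 (x m - x n)
  obtain ⟨ξ, hξ⟩ := cauchySeq_tendsto_of_complete hcau
  have hDx : Tendsto (fun n => D (x n)) atTop (𝓝 (y - c • ξ)) := by
    refine (hlim.sub (hξ.const_smul c)).congr fun n => ?_
    rw [← hx n, addSmul_apply, add_sub_cancel_right]
  have hmem : (ξ, y - c • ξ) ∈ D.graph := by
    have hcl : _root_.IsClosed (D.graph : Set (H × H)) := hD.isClosed
    exact hcl.mem_of_tendsto (hξ.prodMk_nhds hDx) (Eventually.of_forall fun n => D.mem_graph (x n))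
  obtain ⟨ξ', h1, h2⟩ := (mem_graph_iff D).1 hmem
  refine ⟨ξ', ?_⟩
  simp only at h1 h2
  rw [addSmul_apply, h1, h2, sub_add_cancel]

/-- The only vector orthogonal to the range is `0`, since a self-adjoint operator has no eigenvalue
`± i`. -/
theorem range_addSmul_eq_top (hD : IsSelfAdjoint D) {c : ℂ} (hc : starRingEnd ℂ c = -c)
    (hc1 : ‖c‖ = 1) : LinearMap.range (D.addSmul c) = ⊤ := by
  have hcl := isClosed_range_addSmul hD hc hc1
  have : CompleteSpace (LinearMap.range (D.addSmul c)) := hcl.completeSpace_coe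
  rw [← Submodule.orthogonal_eq_bot_iff, Submodule.eq_bot_iff]
  intro η hη
  -- a vector orthogonal to the range is an eigenvector of `D` with eigenvalue `c`
  have h1 : ∀ ξ : D.domain, inner ℂ (c • η) (ξ : H) = inner ℂ η (D ξ) := fun ξ => by
    have := (Submodule.mem_orthogonal' _ _).1 hη _ (LinearMap.mem_range_self (D.addSmul c) ξ)
    rw [addSmul_apply, inner_add_right, inner_smul_right] at this
    rw [inner_smul_left, hc]
    linear_combination -this
  have h2 : η ∈ D.domain := by
    have := mem_adjoint_domain_of_exists (T := D) η ⟨c • η, h1⟩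
    rwa [isSelfAdjoint_def.1 hD] at this
  have h3 : D ⟨η, h2⟩ = c • η := by
    refine hD.dense_domain.eq_of_inner_left ℂ fun v hv => ?_
    rw [h1 ⟨v, hv⟩]
    exact inner_apply_comm_of_isSelfAdjoint hD ⟨η, h2⟩ ⟨v, hv⟩
  have h4 := norm_apply_add_smul_sq hD (c := -c) (by simp [hc]) (by simpa using hc1) ⟨η, h2⟩
  rw [h3] at h4
  simp only [neg_smul, add_neg_cancel, norm_zero] at h4
  have h5 : ‖η‖ ^ 2 = 0 := by
    have := sq_nonneg ‖c • η‖
    have := sq_nonneg ‖η‖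
    linarith
  simpa using h5

/-- The bounded inverse of `D + c`. -/
theorem exists_inverse_addSmul (hD : IsSelfAdjoint D) {c : ℂ} (hc : starRingEnd ℂ c = -c)
    (hc1 : ‖c‖ = 1) :
    ∃ R : H →L[ℂ] H, (∀ ζ, ∃ h : R ζ ∈ D.domain, D ⟨R ζ, h⟩ + c • R ζ = ζ) ∧
      ∀ ξ : D.domain, R (D ξ + c • (ξ : H)) = ξ := by
  have hinj : Function.Injective (D.addSmul c) := by
    refine (injective_iff_map_eq_zero _).2 fun ξ hξ => ?_
    have := norm_le_norm_addSmul hD hc hc1 ξ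
    rw [hξ, norm_zero] at this
    simpa using this
  have hbij : Function.Bijective (D.addSmul c) :=
    ⟨hinj, LinearMap.range_eq_top.1 (range_addSmul_eq_top hD hc hc1)⟩
  let e := LinearEquiv.ofBijective (D.addSmul c) hbij
  refine ⟨LinearMap.mkContinuous (D.domain.subtype ∘ₗ (e.symm : H →ₗ[ℂ] D.domain)) 1 fun ζ => ?_,
    fun ζ => ⟨(e.symm ζ).2, ?_⟩, fun ξ => ?_⟩
  · rw [one_mul]
    refine (norm_le_norm_addSmul hD hc hc1 (e.symm ζ)).trans (le_of_eq ?_)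
    exact congrArg norm (e.apply_symm_apply ζ)
  · exact (e.apply_symm_apply ζ :)
  · exact congrArg Subtype.val (e.symm_apply_apply ξ)

/-- The resolvent `R = (D + i)⁻¹` of a self-adjoint operator is normal, and
`R - R* = - 2 i R* R`. -/
theorem exists_resolvent (hD : IsSelfAdjoint D) :
    ∃ R : H →L[ℂ] H, (∀ ζ, ∃ h : R ζ ∈ D.domain, D ⟨R ζ, h⟩ + Complex.I • R ζ = ζ) ∧
      (∀ ξ : D.domain, R (D ξ + Complex.I • (ξ : H)) = ξ) ∧ IsStarNormal R ∧
      R - star R = (-2 * Complex.I) • (star R * R) := by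
  obtain ⟨R, h1, h2⟩ := exists_inverse_addSmul hD (c := Complex.I) (by simp) (by simp)
  obtain ⟨S, h3, h4⟩ := exists_inverse_addSmul hD (c := -Complex.I) (by simp) (by simp)
  have hS : star R = S := by
    rw [ContinuousLinearMap.star_eq_adjoint]
    refine ((ContinuousLinearMap.eq_adjoint_iff S R).2 fun η ζ => ?_).symm
    obtain ⟨hζ, hζ'⟩ := h1 ζ
    obtain ⟨hη, hη'⟩ := h3 η
    conv_lhs => rw [← hζ']
    conv_rhs => rw [← hη']
    rw [inner_add_right, inner_add_left, inner_smul_left, inner_smul_right]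
    have := inner_apply_comm_of_isSelfAdjoint hD ⟨S η, hη⟩ ⟨R ζ, hζ⟩
    simp only at this
    rw [this]
    simp
  have e1 : R - S = (-2 * Complex.I) • (S * R) := by
    ext ζ
    obtain ⟨hζ, hζ'⟩ := h1 ζ
    have h5 := h4 ⟨R ζ, hζ⟩
    have h6 : D ⟨R ζ, hζ⟩ + (-Complex.I) • R ζ = ζ - (2 * Complex.I) • R ζ := by
      rw [eq_sub_of_add_eq hζ']
      module
    simp only [h6, _root_.map_sub, _root_.map_smul] at h5
    simp only [_root_.sub_apply, _root_.smul_apply, mul_apply_eq_comp]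
    linear_combination (norm := module) (-1 : ℂ) • h5
  have e2 : R - S = (-2 * Complex.I) • (R * S) := by
    ext ζ
    obtain ⟨hζ, hζ'⟩ := h3 ζ
    have h5 := h2 ⟨S ζ, hζ⟩
    have h6 : D ⟨S ζ, hζ⟩ + Complex.I • S ζ = ζ + (2 * Complex.I) • S ζ := by
      rw [eq_sub_of_add_eq hζ']
      module
    simp only [h6, _root_.map_add, _root_.map_smul] at h5
    simp only [_root_.sub_apply, _root_.smul_apply, mul_apply_eq_comp]
    linear_combination (norm := module) h5
  refine ⟨R, h1, h2, ⟨?_⟩, by rw [hS, e1]⟩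
  rw [hS]
  have h5 : (-2 * Complex.I) ≠ 0 := by simp
  exact smul_right_injective (H →L[ℂ] H) h5 (e1.symm.trans e2)

end LinearPMap

/-! ### Scalar measures and projections of a representation of `C(X, ℂ)` -/

/-- A real-valued continuous function, as a complex-valued one. -/
def ContinuousMap.toComplex {X : Type*} [TopologicalSpace X] (f : C(X, ℝ)) : C(X, ℂ) :=
  ⟨fun x => (f x : ℂ), by fun_prop⟩

namespace StarAlgHom

variable {H : Type*} [NormedAddCommGroup H] [InnerProductSpace ℂ H] [CompleteSpace H]
variable {X : Type*} [MetricSpace X] [CompactSpace X] [MeasurableSpace X] [BorelSpace X]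
variable (Φ : C(X, ℂ) →⋆ₐ[ℂ] (H →L[ℂ] H))

omit [CompactSpace X] [MeasurableSpace X] [BorelSpace X] in
theorem inner_apply_star_mul (f g : C(X, ℂ)) (ξ : H) :
    inner ℂ ξ (Φ (star f * g) ξ) = inner ℂ (Φ f ξ) (Φ g ξ) := by
  rw [map_mul, map_star, ContinuousLinearMap.star_eq_adjoint, mul_apply_eq_comp,
    ContinuousLinearMap.adjoint_inner_right]

theorem exists_measure_re (ξ : H) : ∃ μ : Measure X, IsFiniteMeasure μ ∧
    ∀ f : C(X, ℝ), ∫ x, f x ∂μ = (inner ℂ ξ (Φ f.toComplex ξ)).re := by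
  let Λ : CompactlySupportedContinuousMap X ℝ →ₚ[ℝ] ℝ := PositiveLinearMap.mk₀
    { toFun := fun f => (inner ℂ ξ (Φ f.toContinuousMap.toComplex ξ)).re
      map_add' := fun f g => by
        have : (f + g).toContinuousMap.toComplex
            = f.toContinuousMap.toComplex + g.toContinuousMap.toComplex := by
          ext x; simp [ContinuousMap.toComplex]
        rw [this, map_add, _root_.add_apply, inner_add_right, Complex.add_re]
      map_smul' := fun c f => by
        have : (c • f).toContinuousMap.toComplex = (c : ℂ) • f.toContinuousMap.toComplex := by
          ext x; simp [ContinuousMap.toComplex]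
        rw [this, map_smul, _root_.smul_apply, inner_smul_right, Complex.re_ofReal_mul]
        rfl }
    (fun f hf => by
      let g : C(X, ℂ) := ContinuousMap.toComplex ⟨fun x => √(f x), by fun_prop⟩
      have : f.toContinuousMap.toComplex = star g * g := by
        ext x
        have h1 : (0 : ℝ) ≤ f x := hf x
        simp only [g, ContinuousMap.toComplex, ContinuousMap.coe_mk, ContinuousMap.mul_apply,
          ContinuousMap.star_apply]
        rw [Complex.star_def, Complex.conj_ofReal, ← Complex.ofReal_mul, Real.mul_self_sqrt h1]
        rfl
      change 0 ≤ (inner ℂ ξ (Φ f.toContinuousMap.toComplex ξ)).re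
      rw [this, inner_apply_star_mul, inner_self_eq_norm_sq_complex, Complex.ofReal_re]
      positivity)
  refine ⟨RealRMK.rieszMeasure Λ, inferInstance, fun f => ?_⟩
  exact RealRMK.integral_rieszMeasure Λ (CompactlySupportedContinuousMap.continuousMapEquiv f)

/-- Every vector `ξ` has a scalar measure: the measure that represents the positive functional
`f ↦ ⟨Φ(f) ξ, ξ⟩`. -/
theorem exists_measure (ξ : H) : ∃ μ : Measure X, IsFiniteMeasure μ ∧
    ∀ f : C(X, ℂ), ∫ x, f x ∂μ = inner ℂ ξ (Φ f ξ) := by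
  obtain ⟨μ, hμ, h⟩ := exists_measure_re Φ ξ
  have hi : ∀ f : C(X, ℂ), Integrable f μ := fun f => f.continuous.integrable_of_hasCompactSupport
    (HasCompactSupport.of_compactSpace f)
  have hre : ∀ f : C(X, ℂ), (∫ x, f x ∂μ).re = (inner ℂ ξ (Φ f ξ)).re := fun f => by
    have h1 : (∫ x, f x ∂μ).re = ∫ x, (f x).re ∂μ :=
      (Complex.reCLM.integral_comp_comm (hi f)).symm
    have h2 := h ⟨fun x => (f x).re, by fun_prop⟩
    have h3 : ContinuousMap.toComplex ⟨fun x => (f x).re, by fun_prop⟩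
        = (2⁻¹ : ℂ) • (f + star f) := by
      ext x
      simp only [ContinuousMap.toComplex, ContinuousMap.coe_mk, ContinuousMap.smul_apply,
        ContinuousMap.add_apply, ContinuousMap.star_apply, smul_eq_mul]
      rw [Complex.star_def, Complex.add_conj]
      push_cast; ring
    have h4 : inner ℂ ξ (Φ (star f) ξ) = starRingEnd ℂ (inner ℂ ξ (Φ f ξ)) := by
      rw [map_star, ContinuousLinearMap.star_eq_adjoint, ContinuousLinearMap.adjoint_inner_right,
        inner_conj_symm]
    rw [h3, map_smul, map_add, _root_.smul_apply, _root_.add_apply, inner_smul_right,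
      inner_add_right, h4, Complex.add_conj] at h2
    rw [h1]
    refine h2.trans ?_
    rw [← Complex.ofReal_ofNat, ← Complex.ofReal_inv, ← Complex.ofReal_mul,
      Complex.ofReal_re]
    ring
  refine ⟨μ, hμ, fun f => Complex.ext (hre f) ?_⟩
  have h1 := hre ((-Complex.I) • f)
  simp only [ContinuousMap.smul_apply, map_smul, _root_.smul_apply, inner_smul_right,
    smul_eq_mul] at h1
  rw [integral_const_mul] at h1
  simpa using h1

variable {Φ} {μ : H → Measure X} [∀ ξ, IsFiniteMeasure (μ ξ)]

omit [CompactSpace X] [BorelSpace X] [∀ ξ, IsFiniteMeasure (μ ξ)] in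
theorem norm_apply_sq (hμ : ∀ ξ (f : C(X, ℂ)), ∫ x, f x ∂(μ ξ) = inner ℂ ξ (Φ f ξ)) (f : C(X, ℂ))
    (ξ : H) : ‖Φ f ξ‖ ^ 2 = ∫ x, ‖f x‖ ^ 2 ∂(μ ξ) := by
  have h : ((‖Φ f ξ‖ ^ 2 : ℝ) : ℂ) = ((∫ x, ‖f x‖ ^ 2 ∂(μ ξ) : ℝ) : ℂ) := by
    rw [← inner_self_eq_norm_sq_complex, ← inner_apply_star_mul, ← hμ, ← integral_complex_ofReal]
    refine integral_congr_ae (Eventually.of_forall fun x => ?_)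
    simp [Complex.conj_mul']
  exact_mod_cast h

/-- The map `f ↦ Φ(f) ξ` extends to an isometry of `L²` of the scalar measure of `ξ`. -/
theorem exists_isometry (hμ : ∀ ξ (f : C(X, ℂ)), ∫ x, f x ∂(μ ξ) = inner ℂ ξ (Φ f ξ)) (ξ : H) :
    ∃ W : Lp ℂ 2 (μ ξ) →ₗᵢ[ℂ] H, ∀ f : C(X, ℂ), W (ContinuousMap.toLp 2 (μ ξ) ℂ f) = Φ f ξ := by
  let e : C(X, ℂ) →ₗ[ℂ] Lp ℂ 2 (μ ξ) := (ContinuousMap.toLp 2 (μ ξ) ℂ : C(X, ℂ) →L[ℂ] _)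
  let u : C(X, ℂ) →ₗ[ℂ] H :=
    { toFun := fun f => Φ f ξ
      map_add' := fun f g => by simp
      map_smul' := fun c f => by simp }
  have hd : DenseRange e := ContinuousMap.toLp_denseRange ℂ (μ ξ) ℂ (by simp)
  have hn : ∀ f, ‖u f‖ = ‖e f‖ := fun f => by
    refine (pow_left_inj₀ (norm_nonneg _) (norm_nonneg _) two_ne_zero).1 ?_
    have h1 := inner_self_eq_norm_sq_complex (e f)
    change inner ℂ (ContinuousMap.toLp 2 (μ ξ) ℂ f) (ContinuousMap.toLp 2 (μ ξ) ℂ f) = _ at h1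
    rw [ContinuousMap.inner_toLp] at h1
    have h2 : ∫ x, f x * starRingEnd ℂ (f x) ∂(μ ξ) = ((∫ x, ‖f x‖ ^ 2 ∂(μ ξ) : ℝ) : ℂ) := by
      rw [← integral_complex_ofReal]
      refine integral_congr_ae (Eventually.of_forall fun x => ?_)
      simp [Complex.mul_conj']
    rw [h2] at h1
    refine (norm_apply_sq hμ f ξ).trans ?_
    exact_mod_cast h1
  have hW : ∀ f, u.extendOfNorm e (e f) = u f :=
    LinearMap.extendOfNorm_eq hd ⟨1, fun f => by rw [one_mul, hn]⟩
  refine ⟨⟨(u.extendOfNorm e : Lp ℂ 2 (μ ξ) →ₗ[ℂ] H), fun f => ?_⟩, fun f => hW f⟩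
  refine hd.induction_on (p := fun f => ‖u.extendOfNorm e f‖ = ‖f‖) f
    (isClosed_eq (by fun_prop) (by fun_prop)) fun f => ?_
  rw [hW, hn]

/-- The spectral projection of a Borel set `B`. On each vector `ξ` it is the image of the indicator
of `B` under the isometry from `L²` of the scalar measure; it is linear because the indicator can be
approximated by the same continuous function for several scalar measures at once. -/
theorem exists_projection (hμ : ∀ ξ (f : C(X, ℂ)), ∫ x, f x ∂(μ ξ) = inner ℂ ξ (Φ f ξ))
    {B : Set X} (hB : MeasurableSet B) :
    ∃ P : H →L[ℂ] H, IsStarProjection P ∧ ∀ ξ, inner ℂ ξ (P ξ) = (((μ ξ).real B : ℝ) : ℂ) := by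
  choose W hW using exists_isometry hμ
  let b : ∀ ξ, Lp ℂ 2 (μ ξ) := fun ξ => indicatorConstLp 2 hB (measure_ne_top (μ ξ) B) 1
  let p : H → H := fun ξ => W ξ (b ξ)
  have hW1 : ∀ ξ, W ξ (indicatorConstLp 2 MeasurableSet.univ (measure_ne_top (μ ξ) Set.univ) 1)
      = ξ := fun ξ => by
    have : indicatorConstLp 2 MeasurableSet.univ (measure_ne_top (μ ξ) Set.univ) (1 : ℂ)
        = ContinuousMap.toLp 2 (μ ξ) ℂ (1 : C(X, ℂ)) := by
      refine Lp.ext ?_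
      filter_upwards [indicatorConstLp_coeFn (p := 2) (hs := MeasurableSet.univ)
          (hμs := measure_ne_top (μ ξ) Set.univ) (c := (1 : ℂ)),
        ContinuousMap.coeFn_toLp (p := 2) (𝕜 := ℂ) (μ ξ) (1 : C(X, ℂ))] with x h1 h2
      rw [h1, h2]
      simp
    rw [this, hW, map_one]; rfl
  have hinner : ∀ ξ, inner ℂ ξ (p ξ) = (((μ ξ).real B : ℝ) : ℂ) := fun ξ => by
    have h1 := (W ξ).inner_map_map (indicatorConstLp 2 MeasurableSet.univ
      (measure_ne_top (μ ξ) Set.univ) 1) (b ξ)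
    rw [hW1, L2.inner_indicatorConstLp_one_indicatorConstLp_one, Set.univ_inter] at h1
    exact h1
  have hnorm : ∀ ξ, ‖p ξ‖ ^ 2 = (μ ξ).real B := fun ξ => by
    have h1 := (W ξ).inner_map_map (b ξ) (b ξ)
    rw [inner_self_eq_norm_sq_complex, L2.inner_indicatorConstLp_one_indicatorConstLp_one,
      Set.inter_self] at h1
    exact Complex.ofReal_injective h1
  have happrox : ∀ (ν : Measure X) [IsFiniteMeasure ν] (ε : ℝ), 0 < ε → ∃ g : C(X, ℂ),
      ∀ ξ, μ ξ ≤ ν → ‖p ξ - Φ g ξ‖ ≤ ε := fun ν _ ε hε => by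
    obtain ⟨g, hg, -⟩ := (memLp_indicator_const 2 hB (1 : ℂ)
      (Or.inr (measure_ne_top ν B))).exists_boundedContinuous_eLpNorm_sub_le (by simp)
      (ε := ENNReal.ofReal ε) (by simpa using hε)
    refine ⟨g.toContinuousMap, fun ξ hξ => ?_⟩
    rw [← hW, ← (W ξ).map_sub, (W ξ).norm_map, Lp.norm_def]
    refine ENNReal.toReal_le_of_le_ofReal hε.le (le_trans (le_of_eq ?_)
      ((eLpNorm_mono_measure _ hξ).trans hg))
    refine eLpNorm_congr_ae ?_
    filter_upwards [Lp.coeFn_sub (b ξ) (ContinuousMap.toLp 2 (μ ξ) ℂ g.toContinuousMap),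
      indicatorConstLp_coeFn (p := 2) (hs := hB) (hμs := measure_ne_top (μ ξ) B) (c := (1 : ℂ)),
      ContinuousMap.coeFn_toLp (p := 2) (𝕜 := ℂ) (μ ξ) g.toContinuousMap] with x h1 h2 h3
    rw [h1, Pi.sub_apply, h2, h3]; rfl
  have hadd : ∀ ξ η, p (ξ + η) = p ξ + p η := fun ξ η => by
    rw [← sub_eq_zero, ← norm_le_zero_iff]
    refine le_of_forall_pos_le_add fun ε hε => ?_
    obtain ⟨g, hg⟩ := happrox (μ ξ + μ η + μ (ξ + η)) (ε / 3) (by positivity)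
    have h1 := hg ξ ((Measure.le_add_right le_rfl).trans (Measure.le_add_right le_rfl))
    have h2 := hg η ((Measure.le_add_left le_rfl).trans (Measure.le_add_right le_rfl))
    have h3 := hg (ξ + η) (Measure.le_add_left le_rfl)
    have h4 : p (ξ + η) - (p ξ + p η)
        = (p (ξ + η) - Φ g (ξ + η)) - (p ξ - Φ g ξ) - (p η - Φ g η) := by
      rw [map_add]; abel
    rw [h4]
    refine (norm_sub_le _ _).trans ?_
    have := norm_sub_le (p (ξ + η) - Φ g (ξ + η)) (p ξ - Φ g ξ)
    linarith
  have hsmul : ∀ (c : ℂ) ξ, p (c • ξ) = c • p ξ := fun c ξ => by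
    rw [← sub_eq_zero, ← norm_le_zero_iff]
    refine le_of_forall_pos_le_add fun ε hε => ?_
    obtain ⟨g, hg⟩ := happrox (μ ξ + μ (c • ξ)) (ε / (1 + ‖c‖)) (by positivity)
    have h1 := hg ξ (Measure.le_add_right le_rfl)
    have h2 := hg (c • ξ) (Measure.le_add_left le_rfl)
    have h3 : p (c • ξ) - c • p ξ = (p (c • ξ) - Φ g (c • ξ)) - c • (p ξ - Φ g ξ) := by
      rw [map_smul, smul_sub]; abel
    rw [h3]
    refine (norm_sub_le _ _).trans ?_
    rw [norm_smul]
    have h4 := mul_le_mul_of_nonneg_left h1 (norm_nonneg c)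
    have h5 : ε / (1 + ‖c‖) + ‖c‖ * (ε / (1 + ‖c‖)) = ε := by field_simp
    linarith
  have hle : ∀ ξ, ‖p ξ‖ ≤ 1 * ‖ξ‖ := fun ξ => by
    refine (pow_le_pow_iff_left₀ (norm_nonneg _) (by positivity) two_ne_zero).1 ?_
    have h1 := norm_apply_sq hμ 1 ξ
    simp only [map_one, one_apply_eq_self, ContinuousMap.one_apply, norm_one, one_pow,
      integral_const, smul_eq_mul, mul_one] at h1
    rw [one_mul, h1, hnorm]
    exact measureReal_mono (Set.subset_univ _)
  let P : H →L[ℂ] H := LinearMap.mkContinuous ⟨⟨p, hadd⟩, hsmul⟩ 1 hle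
  have hP : star P * P = P := ContinuousLinearMap.eq_of_inner_self_eq fun ξ => by
    rw [mul_apply_eq_comp, ContinuousLinearMap.star_eq_adjoint,
      ContinuousLinearMap.adjoint_inner_right, inner_self_eq_norm_sq_complex]
    exact (congrArg _ (hnorm ξ)).trans (hinner ξ).symm
  have hsa : star P = P := by
    conv_lhs => rw [← hP]
    rw [star_mul, star_star, hP]
  refine ⟨P, ⟨?_, hsa⟩, hinner⟩
  rw [hsa] at hP
  exact hP

end StarAlgHom

/-! ### The spectral theorem for unbounded self-adjoint operators -/

namespace ProjectionValuedMeasure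

variable {H : Type*} [NormedAddCommGroup H] [InnerProductSpace ℂ H] [CompleteSpace H]

/-- A family of scalar measures whose values are the quadratic forms of orthogonal projections comes
from a projection-valued measure. -/
theorem exists_of_measure (μ : H → Measure ℝ) [∀ ξ, IsFiniteMeasure (μ ξ)]
    (huniv : ∀ ξ, (μ ξ).real Set.univ = ‖ξ‖ ^ 2)
    (hproj : ∀ B, MeasurableSet B → ∃ P : H →L[ℂ] H, IsStarProjection P ∧
      ∀ ξ, inner ℂ ξ (P ξ) = (((μ ξ).real B : ℝ) : ℂ)) :
    ∃ E : ProjectionValuedMeasure H, ∀ ξ, E.measure ξ = μ ξ := by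
  choose! P hP hPμ using hproj
  have hnorm : ∀ B, MeasurableSet B → ∀ ξ, ‖P B ξ‖ ^ 2 = (μ ξ).real B := fun B hB ξ => by
    have h1 : star (P B) * P B = P B := by
      rw [(hP B hB).isSelfAdjoint.star_eq]; exact (hP B hB).isIdempotentElem
    have h2 := hPμ B hB ξ
    rw [← h1, mul_apply_eq_comp, ContinuousLinearMap.star_eq_adjoint,
      ContinuousLinearMap.adjoint_inner_right, inner_self_eq_norm_sq_complex] at h2
    exact Complex.ofReal_injective h2
  let E : ProjectionValuedMeasure H :=
    { proj := P
      isStarProjection_proj := hP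
      proj_univ := ContinuousLinearMap.eq_of_inner_self_eq fun ξ => by
        rw [hPμ _ MeasurableSet.univ, huniv, one_apply_eq_self, inner_self_eq_norm_sq_complex]
      hasSum_proj := fun B hB hd ξ => by
        have hU := MeasurableSet.iUnion hB
        -- the tail of the series is the projection of the complement of a finite union
        have htail : ∀ s : Finset ℕ, ‖∑ n ∈ s, P (B n) ξ - P (⋃ n, B n) ξ‖
            = √((μ ξ).real (⋃ n, B n) - ∑ n ∈ s, (μ ξ).real (B n)) := fun s => by
          have hs : MeasurableSet (⋃ n ∈ s, B n) := s.measurableSet_biUnion fun n _ => hB n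
          have hsub : (⋃ n ∈ s, B n) ⊆ ⋃ n, B n := Set.iUnion₂_subset_iUnion _ _
          have hm : ∀ ξ, (μ ξ).real ((⋃ n, B n) \ ⋃ n ∈ s, B n)
              = (μ ξ).real (⋃ n, B n) - ∑ n ∈ s, (μ ξ).real (B n) := fun ξ => by
            rw [measureReal_sdiff hsub hs, measureReal_biUnion_finset (fun i _ j _ h => hd h)
              fun n _ => hB n]
          have hop : P ((⋃ n, B n) \ ⋃ n ∈ s, B n) = P (⋃ n, B n) - ∑ n ∈ s, P (B n) :=
            ContinuousLinearMap.eq_of_inner_self_eq fun ξ => by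
              rw [hPμ _ (hU.diff hs), hm, _root_.sub_apply, sum_apply, inner_sub_right,
                inner_sum, hPμ _ hU, Finset.sum_congr rfl fun n _ => hPμ _ (hB n) ξ]
              push_cast; rfl
          rw [← hm, ← hnorm _ (hU.diff hs), Real.sqrt_sq (norm_nonneg _), hop, _root_.sub_apply,
            sum_apply, norm_sub_rev]
        have hsum : HasSum (fun n => (μ ξ).real (B n)) ((μ ξ).real (⋃ n, B n)) := by
          have h1 : ∑' n, μ ξ (B n) = μ ξ (⋃ n, B n) := (measure_iUnion hd hB).symm
          have h2 := ENNReal.hasSum_toReal (f := fun n => μ ξ (B n))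
            (by rw [h1]; exact measure_ne_top _ _)
          rw [← ENNReal.tsum_toReal_eq fun n => measure_ne_top _ _, h1] at h2
          exact h2
        refine tendsto_iff_norm_sub_tendsto_zero.2 ?_
        simp only [SummationFilter.unconditional_filter, htail]
        have h2 : Tendsto (fun s : Finset ℕ => (μ ξ).real (⋃ n, B n) - ∑ n ∈ s, (μ ξ).real (B n))
            atTop (𝓝 ((μ ξ).real (⋃ n, B n) - (μ ξ).real (⋃ n, B n))) := hsum.const_sub _
        have h3 := (Real.continuous_sqrt.tendsto _).comp h2
        rw [sub_self, Real.sqrt_zero] at h3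
        exact h3 }
  refine ⟨E, fun ξ => ?_⟩
  ext B hB
  rw [E.measure_apply ξ hB]
  change ENNReal.ofReal (inner ℂ ξ (P B ξ)).re = _
  rw [hPμ B hB, Complex.ofReal_re, ofReal_measureReal]

end ProjectionValuedMeasure

/-- The function `x ↦ 1 / (x + i)`. -/
noncomputable def resolventFun (x : ℝ) : ℂ := ((x : ℂ) + Complex.I)⁻¹

theorem ofReal_add_I_ne_zero (x : ℝ) : (x : ℂ) + Complex.I ≠ 0 := fun h => by
  simpa using congrArg Complex.im h

theorem norm_ofReal_add_I_sq (x : ℝ) : ‖(x : ℂ) + Complex.I‖ ^ 2 = x ^ 2 + 1 := by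
  rw [← Complex.normSq_eq_norm_sq, Complex.normSq_apply]
  simp; ring

theorem norm_resolventFun_sq (x : ℝ) : ‖resolventFun x‖ ^ 2 = (x ^ 2 + 1)⁻¹ := by
  rw [resolventFun, norm_inv, inv_pow, norm_ofReal_add_I_sq]

theorem isBoundedBorel_resolventFun : IsBoundedBorel resolventFun := by
  refine ⟨by unfold resolventFun; fun_prop, 1, fun x => ?_⟩
  refine (pow_le_pow_iff_left₀ (norm_nonneg _) zero_le_one two_ne_zero).1 ?_
  rw [norm_resolventFun_sq, one_pow]
  exact inv_le_one_of_one_le₀ (by nlinarith [sq_nonneg x])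

namespace ProjectionValuedMeasure

variable {H : Type*} [NormedAddCommGroup H] [InnerProductSpace ℂ H] [CompleteSpace H]

/-- The spectral theorem in bounded form: an operator with the algebraic properties of a resolvent
`(D + i)⁻¹` is `∫ 1 / (x + i) dE(x)` for a projection-valued measure `E`. -/
theorem exists_calculus_resolventFun_eq (R : H →L[ℂ] H) (hR : IsStarNormal R)
    (hrel : R - star R = (-2 * Complex.I) • (star R * R)) (hd : DenseRange R) :
    ∃ E : ProjectionValuedMeasure H, E.calculus resolventFun = R := by
  let Φ : C(spectrum ℂ R, ℂ) →⋆ₐ[ℂ] (H →L[ℂ] H) := cfcHom hR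
  let z : C(spectrum ℂ R, ℂ) := (ContinuousMap.id ℂ).restrict (spectrum ℂ R)
  have hz : Φ z = R := cfcHom_id hR
  have hz_apply : ∀ x : spectrum ℂ R, z x = x := fun x => rfl
  -- the relation for `R` confines the spectrum to the circle of the points `1 / (x + i)` and `0`
  have hspec : ∀ x : spectrum ℂ R, (x : ℂ) ≠ 0 → resolventFun ((x : ℂ)⁻¹).re = x := fun x hx => by
    have h1 : z - star z = (-2 * Complex.I) • (star z * z) := by
      refine cfcHom_injective hR ?_
      change Φ _ = Φ _
      rw [map_sub, map_star, map_smul, map_mul, map_star, hz, hrel]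
    have h2 := DFunLike.congr_fun h1 x
    simp only [ContinuousMap.sub_apply, ContinuousMap.star_apply, ContinuousMap.smul_apply,
      ContinuousMap.mul_apply, hz_apply, smul_eq_mul] at h2
    have hx' : starRingEnd ℂ (x : ℂ) ≠ 0 := by simpa using hx
    have h3 : (x : ℂ)⁻¹ - starRingEnd ℂ ((x : ℂ)⁻¹) = 2 * Complex.I := by
      rw [map_inv₀]
      field_simp
      rw [Complex.star_def] at h2
      linear_combination -h2
    rw [Complex.sub_conj] at h3
    have h4 : (((x : ℂ)⁻¹).im : ℂ) = 1 := by
      push_cast at h3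
      have := mul_right_cancel₀ Complex.I_ne_zero h3
      linear_combination this / 2
    have h5 : (((x : ℂ)⁻¹).re : ℂ) + Complex.I = (x : ℂ)⁻¹ := by
      conv_rhs => rw [← Complex.re_add_im ((x : ℂ)⁻¹), h4, one_mul]
    rw [resolventFun, h5, inv_inv]
  choose μ hμfin hμ using StarAlgHom.exists_measure Φ
  have hnormsq : ∀ ξ, (μ ξ).real Set.univ = ‖ξ‖ ^ 2 := fun ξ => by
    have h1 := StarAlgHom.norm_apply_sq hμ 1 ξ
    simp only [map_one, one_apply_eq_self, ContinuousMap.one_apply, norm_one, one_pow,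
      integral_const, smul_eq_mul, mul_one] at h1
    exact h1.symm
  have hZ : MeasurableSet {x : spectrum ℂ R | (x : ℂ) = 0} :=
    measurable_subtype_coe (measurableSet_singleton (0 : ℂ))
  -- the point `0` of the spectrum carries no mass, since `R` has dense range
  have hzero : ∀ ξ, (μ ξ) {x : spectrum ℂ R | (x : ℂ) = 0} = 0 := by
    have hrange : ∀ ζ, (μ (R ζ)).real {x : spectrum ℂ R | (x : ℂ) = 0} ≤ 0 := fun ζ => by
      have hδ : ∀ δ : ℝ, 0 < δ →
          (μ (R ζ)).real {x : spectrum ℂ R | (x : ℂ) = 0} ≤ δ * ‖ζ‖ ^ 2 := fun δ hδ => by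
        have hpos : ∀ x : spectrum ℂ R, 0 < δ + ‖(x : ℂ)‖ ^ 2 := fun x => by positivity
        -- `u` dominates the indicator of `0`, while `u(x) |x|² ≤ δ`; and the measure of `R ζ` has
        -- density `|x|²` with respect to that of `ζ`
        let u : C(spectrum ℂ R, ℝ) := ⟨fun x => δ / (δ + ‖(x : ℂ)‖ ^ 2),
          continuous_const.div (by fun_prop) fun x => (hpos x).ne'⟩
        have hu0 : ∀ x, 0 ≤ u x := fun x => (div_pos hδ (hpos x)).le
        have h1 : ∫ x, u x ∂(μ (R ζ)) = ∫ x, u x * ‖(x : ℂ)‖ ^ 2 ∂(μ ζ) := by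
          have h2 := hμ (R ζ) u.toComplex
          have h3 := hμ ζ (star z * (u.toComplex * z))
          rw [StarAlgHom.inner_apply_star_mul, map_mul, hz, mul_apply_eq_comp, ← h2] at h3
          have h4 : ∀ x, (star z * (u.toComplex * z)) x = ((u x * ‖(x : ℂ)‖ ^ 2 : ℝ) : ℂ) :=
            fun x => by
              simp only [ContinuousMap.mul_apply, ContinuousMap.star_apply, hz_apply]
              rw [Complex.star_def]
              have := Complex.conj_mul' (x : ℂ)
              push_cast
              rw [← this]
              change _ * ((u x : ℂ) * _) = _
              ring
          simp only [h4] at h3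
          rw [integral_complex_ofReal] at h3
          have h5 : ∫ x, u.toComplex x ∂(μ (R ζ)) = ((∫ x, u x ∂(μ (R ζ)) : ℝ) : ℂ) :=
            integral_complex_ofReal
          rw [h5] at h3
          exact (Complex.ofReal_injective h3).symm
        have hi : ∀ (f : C(spectrum ℂ R, ℝ)) ξ, Integrable f (μ ξ) := fun f ξ =>
          f.continuous.integrable_of_hasCompactSupport (HasCompactSupport.of_compactSpace f)
        calc (μ (R ζ)).real {x : spectrum ℂ R | (x : ℂ) = 0}
            = ∫ x, Set.indicator {x : spectrum ℂ R | (x : ℂ) = 0} 1 x ∂(μ (R ζ)) :=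
              (integral_indicator_one hZ).symm
          _ ≤ ∫ x, u x ∂(μ (R ζ)) := by
              refine integral_mono ((integrable_const 1).indicator hZ) (hi u _) fun x => ?_
              by_cases hx : (x : ℂ) = 0
              · rw [Set.indicator_of_mem (show x ∈ {x : spectrum ℂ R | (x : ℂ) = 0} from hx)]
                simp [u, hx, hδ.ne']
              · rw [Set.indicator_of_notMem (show x ∉ {x : spectrum ℂ R | (x : ℂ) = 0} from hx)]
                exact hu0 x
          _ = ∫ x, u x * ‖(x : ℂ)‖ ^ 2 ∂(μ ζ) := h1
          _ ≤ ∫ _, δ ∂(μ ζ) := by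
              refine integral_mono (hi (u * ⟨fun x => ‖(x : ℂ)‖ ^ 2, by fun_prop⟩) _)
                (integrable_const δ) fun x => ?_
              change δ / (δ + ‖(x : ℂ)‖ ^ 2) * ‖(x : ℂ)‖ ^ 2 ≤ δ
              rw [div_mul_eq_mul_div, div_le_iff₀ (hpos x)]
              nlinarith [sq_nonneg ‖(x : ℂ)‖]
          _ = δ * ‖ζ‖ ^ 2 := by rw [integral_const, hnormsq, smul_eq_mul, mul_comm]
      refine le_of_forall_pos_le_add fun ε hε => ?_
      refine (hδ (ε / (‖ζ‖ ^ 2 + 1)) (by positivity)).trans ?_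
      rw [zero_add, div_mul_eq_mul_div, div_le_iff₀ (by positivity)]
      nlinarith
    obtain ⟨P, hP, hPμ⟩ := StarAlgHom.exists_projection hμ hZ
    have hPR : ∀ ξ, inner ℂ ξ (P ξ) = 0 := fun ξ =>
      hd.induction_on (p := fun ξ => inner ℂ ξ (P ξ) = 0) ξ
        (isClosed_eq (by fun_prop) continuous_const) fun ζ => by
          rw [hPμ, le_antisymm (hrange ζ) measureReal_nonneg, Complex.ofReal_zero]
    intro ξ
    have h1 := hPμ ξ
    rw [hPR] at h1
    exact (measureReal_eq_zero_iff).1 (by exact_mod_cast h1.symm)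
  have hmeas : Measurable fun x : spectrum ℂ R => ((x : ℂ)⁻¹).re := by fun_prop
  obtain ⟨E, hE⟩ := exists_of_measure (fun ξ => (μ ξ).map fun x : spectrum ℂ R => ((x : ℂ)⁻¹).re)
    (fun ξ => by
      rw [map_measureReal_apply hmeas MeasurableSet.univ, Set.preimage_univ, hnormsq])
    (fun B hB => by
      obtain ⟨P, hP, hPμ⟩ := StarAlgHom.exists_projection hμ (hmeas hB)
      exact ⟨P, hP, fun ξ => by rw [hPμ, map_measureReal_apply hmeas hB]⟩)
  refine ⟨E, E.calculus_eq isBoundedBorel_resolventFun fun ξ => ?_⟩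
  have hξ := hμ ξ z
  rw [hz] at hξ
  rw [hE, integral_map hmeas.aemeasurable
    isBoundedBorel_resolventFun.measurable.aestronglyMeasurable, ← hξ]
  refine integral_congr_ae ?_
  have h1 : ∀ᵐ x : spectrum ℂ R ∂(μ ξ), ¬ (x : ℂ) = 0 := by
    rw [ae_iff]; simpa using hzero ξ
  filter_upwards [h1] with x hx
  exact (hspec x hx).symm

/-- The **spectral theorem**: every self-adjoint operator, bounded or not, has a spectral
measure. -/
theorem exists_isSpectralMeasureOf {D : H →ₗ.[ℂ] H} (hD : IsSelfAdjoint D) :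
    ∃ E : ProjectionValuedMeasure H, E.IsSpectralMeasureOf D := by
  obtain ⟨R, h1, h2, hR, hrel⟩ := LinearPMap.exists_resolvent hD
  have hd : DenseRange R := hD.dense_domain.mono fun ξ hξ => ⟨_, h2 ⟨ξ, hξ⟩⟩
  obtain ⟨E, hE⟩ := exists_calculus_resolventFun_eq R hR hrel hd
  have hb := isBoundedBorel_resolventFun
  refine ⟨E, fun ξ => ⟨fun hξ => ?_, fun hξ => ?_⟩, fun ξ => ?_⟩
  · have h3 := h2 ⟨ξ, hξ⟩
    simp only at h3
    rw [← h3, ← hE, E.integrable_measure_calculus hb]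
    refine Integrable.of_bound (by
      have := hb.measurable
      exact Measurable.aestronglyMeasurable (by fun_prop)) 1 (Eventually.of_forall fun x => ?_)
    rw [norm_resolventFun_sq, smul_eq_mul, Real.norm_of_nonneg (by positivity),
      inv_mul_le_iff₀ (by positivity)]
    linarith
  · -- `ξ = R ζ` for the limit `ζ` of the truncations of `∫ (x + i) dE(x) ξ`
    let I : ℕ → Set ℝ := fun n => Set.Icc (-n) n
    have hI : ∀ n, MeasurableSet (I n) := fun n => measurableSet_Icc
    have hev : ∀ x : ℝ, ∀ᶠ n in atTop, x ∈ I n := fun x => by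
      filter_upwards [eventually_ge_atTop ⌈|x|⌉₊] with n hn
      exact abs_le.1 (Nat.ceil_le.1 hn)
    let s : ℕ → ℝ → ℂ := fun n => (I n).indicator fun x => (x : ℂ) + Complex.I
    have hs : ∀ n, IsBoundedBorel (s n) := fun n => by
      refine ⟨Measurable.indicator (by fun_prop) (hI n), n + 1, fun x => ?_⟩
      by_cases hx : x ∈ I n
      · rw [show s n x = x + Complex.I from Set.indicator_of_mem hx _]
        refine (norm_add_le _ _).trans ?_
        rw [Complex.norm_I, Complex.norm_real]
        exact add_le_add_left (abs_le.2 hx) 1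
      · rw [show s n x = 0 from Set.indicator_of_notMem hx _, norm_zero]
        positivity
    obtain ⟨ζ, hζ⟩ := E.exists_tendsto_calculus (l := atTop) (ξ := ξ) hs
      (f := fun x => (x : ℂ) + Complex.I) (b := fun x => √(x ^ 2 + 1))
      (by
        have : ∀ x : ℝ, √(x ^ 2 + 1) ^ 2 = x ^ 2 + 1 := fun x => Real.sq_sqrt (by positivity)
        simp only [this]
        exact hξ.add (integrable_const 1))
      (Eventually.of_forall fun n x => by
        refine (norm_indicator_le_norm_self (fun x : ℝ => (x : ℂ) + Complex.I) x).trans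
          (Real.le_sqrt_of_sq_le ?_)
        exact (norm_ofReal_add_I_sq x).le)
      (fun x => tendsto_const_nhds.congr' <| by
        filter_upwards [hev x] with n hn
        exact (Set.indicator_of_mem hn fun x : ℝ => (x : ℂ) + Complex.I).symm)
    have h3 : Tendsto (fun n => R (E.calculus (s n) ξ)) atTop (𝓝 (R ζ)) :=
      (R.continuous.tendsto ζ).comp hζ
    have h4 : Tendsto (fun n => R (E.calculus (s n) ξ)) atTop (𝓝 ξ) := by
      have h5 := E.tendsto_calculus (l := atTop)
        (F := fun n => (I n).indicator (1 : ℝ → ℂ)) (fun n => .indicator_one (hI n)) (.const 1)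
        (C := 1) (fun n x => (norm_indicator_le_norm_self (1 : ℝ → ℂ) x).trans (by simp))
        (fun x => tendsto_const_nhds.congr' <| by
          filter_upwards [hev x] with n hn
          exact (Set.indicator_of_mem hn (1 : ℝ → ℂ)).symm) ξ
      rw [E.calculus_const, one_smul, one_apply_eq_self] at h5
      refine h5.congr fun n => ?_
      rw [← hE, ← ContinuousLinearMap.comp_apply, ← E.calculus_mul hb (hs n)]
      congr 2
      ext x
      by_cases hx : x ∈ I n
      · simp [s, hx, resolventFun, inv_mul_cancel₀ (ofReal_add_I_ne_zero x)]
      · simp [s, hx]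
    rw [tendsto_nhds_unique h4 h3]
    exact (h1 ζ).1
  · set ζ := D ξ + Complex.I • (ξ : H) with hζ
    have h3 : E.calculus resolventFun ζ = ξ := by rw [hE]; exact h2 ξ
    have h4 : D ξ = ζ - Complex.I • (ξ : H) := by rw [hζ, add_sub_cancel_right]
    have h5 : inner ℂ (ξ : H) ζ = ∫ x, starRingEnd ℂ (resolventFun x) ∂(E.measure ζ) := by
      rw [← h3, integral_conj, ← E.inner_calculus hb, inner_conj_symm]
    have h6 : inner ℂ (ξ : H) (ξ : H) = ∫ x, ((‖resolventFun x‖ ^ 2 : ℝ) : ℂ) ∂(E.measure ζ) := by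
      rw [integral_complex_ofReal, ← E.norm_calculus_sq hb, h3, inner_self_eq_norm_sq_complex]
    have hi : Integrable (fun x => ((‖resolventFun x‖ ^ 2 : ℝ) : ℂ)) (E.measure ζ) := by
      have := (hb.conj.mul hb).integrable (E.measure ζ)
      simpa [Complex.conj_mul'] using this
    rw [h4, inner_sub_right, inner_smul_right, h5, h6, ← integral_const_mul,
      ← integral_sub (hb.conj.integrable _) (hi.const_mul _), ← h3, E.integral_measure_calculus hb,
      ← integral_complex_ofReal]
    refine integral_congr_ae (Eventually.of_forall fun x => ?_)
    have h7 := ofReal_add_I_ne_zero x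
    have h8 : (x : ℂ) - Complex.I ≠ 0 := fun h => by simpa using congrArg Complex.im h
    have h9 : ((x : ℂ) ^ 2 + 1) = ((x : ℂ) + Complex.I) * ((x : ℂ) - Complex.I) := by
      linear_combination Complex.I_sq
    simp only [norm_resolventFun_sq, smul_eq_mul]
    push_cast
    rw [h9, resolventFun, map_inv₀, map_add, Complex.conj_ofReal, Complex.conj_I, ← sub_eq_add_neg]
    field_simp
    ring

end ProjectionValuedMeasure

theorem isSpectralMeasureOf_spectralMeasure {H : Type*} [NormedAddCommGroup H]
    [InnerProductSpace ℂ H] [CompleteSpace H] {D : H →ₗ.[ℂ] H} (hD : IsSelfAdjoint D) :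
    (spectralMeasure D).IsSpectralMeasureOf D :=
  Classical.epsilon_spec (ProjectionValuedMeasure.exists_isSpectralMeasureOf hD)

/-! ### Smooth operators preserve smooth vectors -/

section SmoothOperators

variable {H : Type*} [NormedAddCommGroup H] [InnerProductSpace ℂ H] [CompleteSpace H]
variable {H' : Type*} [NormedAddCommGroup H'] [InnerProductSpace ℂ H'] [CompleteSpace H']

/-- The orbit of `X ξ` is the smooth curve `k ↦ exp (i k D') X exp (- i k D)` of operators applied
to the smooth orbit of `ξ`. -/
theorem IsSmoothOperator.isSmoothVector_apply {D : H →ₗ.[ℂ] H} {D' : H' →ₗ.[ℂ] H'}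
    (hD : IsSelfAdjoint D) (hD' : IsSelfAdjoint D') {X : H →L[ℂ] H'} (hX : IsSmoothOperator D D' X)
    {ξ : H} (hξ : IsSmoothVector D ξ) : IsSmoothVector D' (X ξ) := by
  have hE := isSpectralMeasureOf_spectralMeasure hD
  have hE' := isSpectralMeasureOf_spectralMeasure hD'
  rw [hE.isSmoothVector_iff_contDiff hD.dense_domain] at hξ
  rw [hE'.isSmoothVector_iff_contDiff hD'.dense_domain]
  have h1 := ((ContinuousLinearMap.restrictScalarsL ℂ H H' ℝ ℝ).contDiff.comp hX).clm_apply hξ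
  convert h1 using 2 with k
  have h2 := congrArg (fun A : H →L[ℂ] H => A ξ) ((spectralMeasure D).expI_neg_comp k)
  simp only [ContinuousLinearMap.comp_apply, one_apply_eq_self] at h2
  change _ = expI D' k (X (expI D (-k) ((spectralMeasure D).expI k ξ)))
  simp only [expI, h2]

end SmoothOperators

/-! ### Comparison of weak limits by characteristic functions -/

theorem MeasureTheory.FiniteMeasure.tendsto_of_charFun_sub_tendsto_zero
    {μ ν : ℕ → FiniteMeasure ℝ} (hμ : ∀ n, IsProbabilityMeasure (μ n : Measure ℝ))
    (hν : ∀ n, IsProbabilityMeasure (ν n : Measure ℝ))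
    (h : ∀ s, Tendsto (fun n => charFun (ν n : Measure ℝ) s - charFun (μ n : Measure ℝ) s) atTop
      (𝓝 0)) {m : FiniteMeasure ℝ} (hm : Tendsto μ atTop (𝓝 m)) : Tendsto ν atTop (𝓝 m) := by
  -- no mass is lost in the limit, so that Lévy's theorem applies
  have hm1 : IsProbabilityMeasure (m : Measure ℝ) := by
    have h1 : Tendsto (fun n => (μ n).mass) atTop (𝓝 m.mass) :=
      (FiniteMeasure.continuous_mass.tendsto m).comp hm
    have h2 : ∀ n, (μ n).mass = 1 := fun n => by
      have := (hμ n).measure_univ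
      rw [← FiniteMeasure.ennreal_mass] at this
      exact_mod_cast this
    simp only [h2] at h1
    refine ⟨?_⟩
    rw [← FiniteMeasure.ennreal_mass, ← tendsto_nhds_unique tendsto_const_nhds h1]
    rfl
  let μ' : ℕ → ProbabilityMeasure ℝ := fun n => ⟨μ n, hμ n⟩
  let ν' : ℕ → ProbabilityMeasure ℝ := fun n => ⟨ν n, hν n⟩
  let m' : ProbabilityMeasure ℝ := ⟨m, hm1⟩
  have h1 : Tendsto μ' atTop (𝓝 m') :=
    (ProbabilityMeasure.tendsto_nhds_iff_toFiniteMeasure_tendsto_nhds atTop).2 hm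
  have h2 : Tendsto ν' atTop (𝓝 m') := ProbabilityMeasure.tendsto_iff_tendsto_charFun.2 fun s => by
    have h3 := (h s).add (ProbabilityMeasure.tendsto_iff_tendsto_charFun.1 h1 s)
    rw [zero_add] at h3
    refine h3.congr fun n => ?_
    exact sub_add_cancel _ _
  exact (ProbabilityMeasure.tendsto_nhds_iff_toFiniteMeasure_tendsto_nhds atTop).1 h2

/-! ### Similar walks have the same limit distributions -/

namespace QuantumWalk

variable {H : Type*} [NormedAddCommGroup H] [InnerProductSpace ℂ H] [CompleteSpace H]
variable {H' : Type*} [NormedAddCommGroup H'] [InnerProductSpace ℂ H'] [CompleteSpace H']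
variable {W : QuantumWalk H} {W' : QuantumWalk H'}

theorem norm_evolution_apply (W : QuantumWalk H) (t : ℤ) (ξ : H) : ‖W.evolution t ξ‖ = ‖ξ‖ :=
  Unitary.norm_map (W.U ^ t) ξ

theorem evolution_succ_apply (W : QuantumWalk H) (t : ℕ) (ξ : H) :
    W.evolution (t + 1 : ℕ) ξ = (W.U : H →L[ℂ] H) (W.evolution t ξ) := by
  simp only [evolution, zpow_natCast, pow_succ', Submonoid.coe_mul, mul_apply_eq_comp]

theorem IsIntertwiner.apply_evolution {X : H →L[ℂ] H'} (hX : W.IsIntertwiner W' X) (t : ℕ)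
    (ξ : H) : X (W.evolution t ξ) = W'.evolution t (X ξ) := by
  have h1 : ∀ η, X ((W.U : H →L[ℂ] H) η) = (W'.U : H' →L[ℂ] H') (X η) := fun η => by
    have := congrArg (fun A : H →L[ℂ] H' => A η) hX
    simpa [evolution] using this
  induction t with
  | zero => simp [evolution]
  | succ t ih =>
    rw [evolution_succ_apply, evolution_succ_apply, h1, ih]

theorem isProbabilityMeasure_distribution (W : QuantumWalk H) {ξ : H} (hξ : ‖ξ‖ = 1) (t : ℕ) :
    IsProbabilityMeasure (W.distribution ξ t : Measure ℝ) := by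
  have : IsProbabilityMeasure ((spectralMeasure W.D).measure (W.evolution t ξ)) :=
    ⟨by rw [ProjectionValuedMeasure.measure_univ, norm_evolution_apply, hξ]; simp⟩
  exact Measure.isProbabilityMeasure_map (by fun_prop)

theorem charFun_distribution (W : QuantumWalk H) (ξ : H) (t : ℕ) (s : ℝ) :
    charFun (W.distribution ξ t : Measure ℝ) s
      = inner ℂ (W.evolution t ξ) (expI W.D (s / t) (W.evolution t ξ)) := by
  rw [expI, ProjectionValuedMeasure.inner_expI, charFun_apply_real]
  change ∫ x, _ ∂(Measure.map (fun x : ℝ => x / (t : ℝ)) _) = _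
  rw [integral_map (by fun_prop) (by fun_prop)]
  refine integral_congr_ae (Eventually.of_forall fun x => ?_)
  simp only
  congr 1
  push_cast; ring

/-- Only the norm continuity at `0` of `k ↦ exp (i k D') V exp (- i k D)` matters here: rescaling
position by `1 / t` evaluates it at `k = s / t`. -/
theorem IsSimilarityBy.tendsto_charFun_sub {V : H ≃ₗᵢ[ℂ] H'} (hV : W.IsSimilarityBy W' V) {ξ : H}
    (hξ : ‖ξ‖ = 1) (s : ℝ) :
    Tendsto (fun t : ℕ => charFun (W'.distribution (V ξ) t : Measure ℝ) s
      - charFun (W.distribution ξ t : Measure ℝ) s) atTop (𝓝 0) := by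
  set V' : H →L[ℂ] H' := (V.toContinuousLinearEquiv : H →L[ℂ] H') with hV'
  have hVap : ∀ η, V' η = V η := fun η => rfl
  let X : ℝ → H →L[ℂ] H' := fun k => expI W'.D k ∘L V' ∘L expI W.D (-k)
  have hX : Tendsto (fun t : ℕ => ‖X (s / t) - V'‖) atTop (𝓝 0) := by
    have h0 : X 0 = V' := by
      simp only [X, expI, neg_zero, ProjectionValuedMeasure.expI_zero]; rfl
    have h1 : Continuous X := hV.2.continuous
    have h2 : Tendsto (fun t : ℕ => X (s / t)) atTop (𝓝 V') := by
      rw [← h0]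
      exact (h1.tendsto 0).comp (tendsto_const_div_atTop_nhds_zero_nat s)
    exact tendsto_iff_norm_sub_tendsto_zero.1 h2
  refine squeeze_zero_norm (fun t => ?_) hX
  set ζ := W.evolution t ξ with hζ
  have hζ1 : ‖ζ‖ = 1 := by rw [hζ, norm_evolution_apply, hξ]
  set k : ℝ := s / t
  have h1 : W'.evolution t (V ξ) = V ζ := (hV.1.apply_evolution t ξ).symm
  have h2 := congrArg (fun A : H →L[ℂ] H => A ζ) ((spectralMeasure W.D).expI_neg_comp k)
  simp only [ContinuousLinearMap.comp_apply, one_apply_eq_self] at h2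
  have h3 : (X k - V') (expI W.D k ζ) = expI W'.D k (V ζ) - V (expI W.D k ζ) := by
    simp only [X, _root_.sub_apply, ContinuousLinearMap.comp_apply, hVap]
    simp only [expI, h2]
  rw [charFun_distribution, charFun_distribution, h1, ← hζ, ← V.inner_map_map ζ, ← inner_sub_right,
    ← h3]
  refine (norm_inner_le_norm _ _).trans ?_
  rw [V.norm_map, hζ1, one_mul]
  refine ((X k - V').le_opNorm _).trans ?_
  rw [expI, ProjectionValuedMeasure.norm_expI_apply, hζ1, mul_one]

theorem IsSimilarityBy.isLimitDistribution_iff {V : H ≃ₗᵢ[ℂ] H'} (hV : W.IsSimilarityBy W' V)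
    {ξ : H} (hξ : ‖ξ‖ = 1) (μ : FiniteMeasure ℝ) :
    W'.IsLimitDistribution (V ξ) μ ↔ W.IsLimitDistribution ξ μ := by
  have hp := W.isProbabilityMeasure_distribution hξ
  have hp' := W'.isProbabilityMeasure_distribution (ξ := V ξ) (by rw [V.norm_map, hξ])
  refine ⟨FiniteMeasure.tendsto_of_charFun_sub_tendsto_zero hp' hp fun s => ?_,
    FiniteMeasure.tendsto_of_charFun_sub_tendsto_zero hp hp' fun s => hV.tendsto_charFun_sub hξ s⟩
  simpa using (hV.tendsto_charFun_sub hξ s).neg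

end QuantumWalk

theorem mainTheorem5
    {H₁ : Type*} [NormedAddCommGroup H₁] [InnerProductSpace ℂ H₁] [CompleteSpace H₁]
    {H₂ : Type*} [NormedAddCommGroup H₂] [InnerProductSpace ℂ H₂] [CompleteSpace H₂]
    (W₁ : QuantumWalk H₁) (W₂ : QuantumWalk H₂)
    (hW₁ : W₁.IsSmooth) (hW₂ : W₂.IsSmooth)
    (V : H₁ ≃ₗᵢ[ℂ] H₂) (hV : W₁.IsSimilarityBy W₂ V)
    (ξ : H₁) (hξ_norm : ‖ξ‖ = 1) (hξ : IsSmoothVector W₁.D ξ) :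
    IsSmoothVector W₂.D (V ξ) ∧
      (W₂.HasLimitDistribution (V ξ) ↔ W₁.HasLimitDistribution ξ) ∧
      ∀ μ₁ μ₂ : FiniteMeasure ℝ, W₁.IsLimitDistribution ξ μ₁ →
        W₂.IsLimitDistribution (V ξ) μ₂ → μ₁ = μ₂ :=
  ⟨hV.2.isSmoothVector_apply W₁.isSelfAdjoint_D W₂.isSelfAdjoint_D hξ,
    exists_congr fun μ => hV.isLimitDistribution_iff hξ_norm μ,
    fun μ₁ _ h₁ h₂ => tendsto_nhds_unique ((hV.isLimitDistribution_iff hξ_norm μ₁).2 h₁) h₂⟩
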